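/- Let $|\psi\rangle\in\mathbb{C}^{d_A}\otimes\mathbb{C}^{d_B}$ be a unit vector, $\psi=|\psi\rangle\langle\psi|$, $d=\min\{d_A,d_B\}$, and let $\varepsilon\in[0,1)$. Let $\xi_\psi=(\alpha_1,\dots,\alpha_d)\in\mathbb{R}^d_+$ be the vector of Schmidt coefficients of $|\psi\rangle$, i.e. $|\psi\rangle=\sum_{i=1}^d\alpha_i\,|e_i\rangle\otimes|f_i\rangle$ with $\alpha_i\ge 0$ and orthonormal families $(e_i)$, $(f_i)$ (such a decomposition exists). For bipartite systems write $T_B$ for the partial transpose on the second party, $\mathsf{SEP}$ for the convex hull of the pure product states, $\mathsf{PPT}_+$ for the set of density matrices $X$ with $X^{T_B}\succeq0$, and $\mathsf{R}=\{X\succeq 0: \|X^{T_B}\|_1\le 1\}$ for the Rains set. Let $\mathcal{O}$ be any one of the following classes of completely positive trace-preserving (CPTP) maps $\Lambda:AB\to A'B'$: * 1-LOCC: $\Lambda=\sum_j E_j\otimes D_j$ (a finite sum), where $\{E_j\}$ is an instrument of Alice (completely positive maps whose sum is trace preserving) and every $D_j$ is a CPTP map of Bob; * LOCC: maps implemented by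 local operations and classical communication with finitely many rounds, where in every round one party applies an instrument (with finitely many outcomes, chosen depending on the earlier outcomes) to its own system and announces the outcome; * PPT: CPTP maps such that $T_{B'}\circ\Lambda\circ T_B$ is completely positive; * Rains-preserving maps: CPTP maps with $\Lambda(\mathsf{R})\subseteq\mathsf{R}$; * $\mathsf{PPT}_+$-preserving maps: CPTP maps with $\Lambda(\mathsf{PPT}_+)\subseteq\mathsf{PPT}_+$; * SEPP (separability-preserving maps): CPTP maps with $\Lambda(\mathsf{SEP})\subseteq\mathsf{SEP}$. Let $|\Psi_m\rangle=\frac1{\sqrt m}\sum_{i=1}^m|ii\rangle$ and $\Psi_m=|\Psi_m\rangle\langle\Psi_m|$. Define the fidelity of distillation $F_{\mathcal O}(\rho,m)=\sup_{\Lambda\in\mathcal O}\operatorname{Tr}(\Lambda(\rho)\Psi_m)$, the supremum being over the maps in $\mathcal O$ with output space $\mathbb{C}^m\otimes\mathbb{C}^m$, and the one-shot $\varepsilon$-error distillable entanglement $$E^{(1),\varepsilon}_{d,\mathcal O}(\rho)=\log_2\max\{m\in\mathbb{N},\ m\ge1: F_{\mathcal O}(\rho,m)\ge 1-\varepsilon\}.$$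 Write $\lfloor x\rfloor_{\log}=\log_2\lfloor 2^x\rfloor$. Then, for each of these six classes $\mathcal O$, the maximum defining $E^{(1),\varepsilon}_{d,\mathcal O}(\psi)$ exists and $$E^{(1),\varepsilon}_{d,\mathcal O}(\psi)=\Big\lfloor-\log_2\min\big\{\|\omega\|_{\infty}^2:\ \omega\in\mathbb{R}^d_+,\ \langle\xi_\psi,\omega\rangle\ge\sqrt{1-\varepsilon},\ \|\omega\|_{2}\le1\big\}\Big\rfloor_{\log},$$ where the minimum is attained and positive. Moreover this minimum is the optimal value of a convex quadratically constrained linear program, namely: minimise $s$ over $(\omega,s)\in\mathbb{R}^d\times\mathbb{R}$ subject to $\omega_i^2\le s$ and $\omega_i\ge0$ for all $i$, $\sum_i\omega_i^2\le1$ and $\langle\xi_\psi,\omega\rangle\ge\sqrt{1-\varepsilon}$; a pair $(\omega,s)$ is feasible for it if and only if $\omega$ is feasible for the minimisation above and $\|\omega\|_\infty^2\le s$. -/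

import Mathlib

open scoped Matrix ComplexOrder

noncomputable section

/-- A linear map between matrix algebras (a candidate quantum operation). -/
abbrev SuperOp (n k : Type) : Type := Matrix n n ℂ →ₗ[ℂ] Matrix k k ℂ

/-- `E ⊗ id` on the operators of a bipartite system. -/
def SuperOp.onLeft {a a' : Type} (E : SuperOp a a') (b : Type) : SuperOp (a × b) (a' × b) where
  toFun X := Matrix.of fun p q => E (Matrix.of fun i j => X (i, p.2) (j, q.2)) p.1 q.1
  map_add' X Y := by
    ext p q
    exact congrFun (congrFun (E.map_add (Matrix.of fun i j => X (i, p.2) (j, q.2))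
      (Matrix.of fun i j => Y (i, p.2) (j, q.2))) p.1) q.1
  map_smul' z X := by
    ext p q
    exact congrFun (congrFun (E.map_smul z
      (Matrix.of fun i j => X (i, p.2) (j, q.2))) p.1) q.1

/-- `id ⊗ D` on the operators of a bipartite system. -/
def SuperOp.onRight {b b' : Type} (D : SuperOp b b') (a : Type) : SuperOp (a × b) (a × b') where
  toFun X := Matrix.of fun p q => D (Matrix.of fun i j => X (p.1, i) (q.1, j)) p.2 q.2
  map_add' X Y := by
    ext p q
    exact congrFun (congrFun (D.map_add (Matrix.of fun i j => X (p.1, i) (q.1, j))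
      (Matrix.of fun i j => Y (p.1, i) (q.1, j))) p.2) q.2
  map_smul' z X := by
    ext p q
    exact congrFun (congrFun (D.map_smul z
      (Matrix.of fun i j => X (p.1, i) (q.1, j))) p.2) q.2

/-- The tensor product `E ⊗ D` of two maps. -/
def SuperOp.tensor {a a' b b' : Type} (E : SuperOp a a') (D : SuperOp b b') :
    SuperOp (a × b) (a' × b') :=
  (E.onLeft b').comp (D.onRight a)

/-- Complete positivity: `id_r ⊗ Λ` preserves positive semidefiniteness for every `r`. -/
def SuperOp.IsCP {n k : Type} (Λ : SuperOp n k) : Prop :=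
  ∀ (r : ℕ) (X : Matrix (Fin r × n) (Fin r × n) ℂ),
    X.PosSemidef → (Λ.onRight (Fin r) X).PosSemidef

/-- Completely positive and trace preserving. -/
def SuperOp.IsCPTP {n k : Type} [Fintype n] [Fintype k] (Λ : SuperOp n k) : Prop :=
  Λ.IsCP ∧ ∀ X, (Λ X).trace = X.trace

/-- A quantum instrument: finitely many completely positive maps, possibly with different output
systems, whose sum of traces is preserved. -/
def IsInstrument {n N : ℕ} {k : Fin N → ℕ} (E : ∀ j, SuperOp (Fin n) (Fin (k j))) : Prop :=
  (∀ j, (E j).IsCP) ∧ ∀ X, ∑ j, (E j X).trace = X.trace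

/-- Partial transpose on the second party. -/
def partialTranspose (a b : Type) : SuperOp (a × b) (a × b) where
  toFun X := Matrix.of fun p q => X (p.1, q.2) (q.1, p.2)
  map_add' _ _ := rfl
  map_smul' _ _ := rfl

/-- The trace norm `Tr √(Xᴴ X)`, as the sum of the singular values. -/
def traceNorm {n : Type} [Fintype n] [DecidableEq n] (X : Matrix n n ℂ) : ℝ :=
  ∑ i, Real.sqrt ((Matrix.isHermitian_conjTranspose_mul_self X).eigenvalues i)

/-- The rank-one operator `|x⟩⟨x|`. -/
def rankOne {n : Type} (x : n → ℂ) : Matrix n n ℂ := Matrix.vecMulVec x (star x)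

/-- The set of separable states: the convex hull of the pure product states. -/
def separableStates (a b : ℕ) : Set (Matrix (Fin a × Fin b) (Fin a × Fin b) ℂ) :=
  convexHull ℝ {X | ∃ (φ : EuclideanSpace ℂ (Fin a)) (η : EuclideanSpace ℂ (Fin b)),
    ‖φ‖ = 1 ∧ ‖η‖ = 1 ∧ X = rankOne fun p => φ p.1 * η p.2}

/-- The set of states with positive partial transpose. -/
def pptStates (a b : ℕ) : Set (Matrix (Fin a × Fin b) (Fin a × Fin b) ℂ) :=
  {X | X.trace = 1 ∧ X.PosSemidef ∧ (partialTranspose (Fin a) (Fin b) X).PosSemidef}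

/-- The Rains set. -/
def rainsSet (a b : ℕ) : Set (Matrix (Fin a × Fin b) (Fin a × Fin b) ℂ) :=
  {X | X.PosSemidef ∧ traceNorm (partialTranspose (Fin a) (Fin b) X) ≤ 1}

/-- One-way LOCC: Alice applies an instrument and sends the outcome `j` to Bob, who applies a
channel depending on `j`. -/
def IsOneWayLOCC {a b a' b' : ℕ} (Λ : SuperOp (Fin a × Fin b) (Fin a' × Fin b')) : Prop :=
  ∃ (N : ℕ) (E : Fin N → SuperOp (Fin a) (Fin a')) (D : Fin N → SuperOp (Fin b) (Fin b')),
    IsInstrument E ∧ (∀ j, (D j).IsCPTP) ∧ Λ = ∑ j, (E j).tensor (D j)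

/-- LOCC: protocols with finitely many rounds. In each round one party applies an instrument to
its own system and broadcasts the outcome; the rest of the protocol may depend on this outcome.
At the end both parties apply local channels. -/
inductive IsLOCC {a' b' : ℕ} :
    ∀ {a b : ℕ}, SuperOp (Fin a × Fin b) (Fin a' × Fin b') → Prop
  | localOps {a b : ℕ} (E : SuperOp (Fin a) (Fin a')) (D : SuperOp (Fin b) (Fin b'))
      (hE : E.IsCPTP) (hD : D.IsCPTP) : IsLOCC (E.tensor D)
  | alice {a b N : ℕ} (c : Fin N → ℕ) (E : ∀ j, SuperOp (Fin a) (Fin (c j)))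
      (Λ : ∀ j, SuperOp (Fin (c j) × Fin b) (Fin a' × Fin b'))
      (hE : IsInstrument E) (hΛ : ∀ j, IsLOCC (Λ j)) :
      IsLOCC (∑ j, (Λ j).comp ((E j).onLeft (Fin b)))
  | bob {a b N : ℕ} (c : Fin N → ℕ) (D : ∀ j, SuperOp (Fin b) (Fin (c j)))
      (Λ : ∀ j, SuperOp (Fin a × Fin (c j)) (Fin a' × Fin b'))
      (hD : IsInstrument D) (hΛ : ∀ j, IsLOCC (Λ j)) :
      IsLOCC (∑ j, (Λ j).comp ((D j).onRight (Fin a)))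

/-- The six classes of operations under consideration. -/
inductive OpClass : Type
  | oneWayLOCC
  | LOCC
  | PPT
  | rainsPreserving
  | pptPreserving
  | separabilityPreserving

/-- The operations `AB → A'B'` in a given class, where `a, b, a', b'` are the local dimensions. -/
def OpClass.ops (a b a' b' : ℕ) : OpClass → Set (SuperOp (Fin a × Fin b) (Fin a' × Fin b'))
  | .oneWayLOCC => {Λ | IsOneWayLOCC Λ}
  | .LOCC => {Λ | IsLOCC Λ}
  | .PPT => {Λ | Λ.IsCPTP ∧
      SuperOp.IsCP ((partialTranspose (Fin a') (Fin b')).comp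
        (Λ.comp (partialTranspose (Fin a) (Fin b))))}
  | .rainsPreserving => {Λ | Λ.IsCPTP ∧ ∀ X ∈ rainsSet a b, Λ X ∈ rainsSet a' b'}
  | .pptPreserving => {Λ | Λ.IsCPTP ∧ ∀ X ∈ pptStates a b, Λ X ∈ pptStates a' b'}
  | .separabilityPreserving =>
      {Λ | Λ.IsCPTP ∧ ∀ X ∈ separableStates a b, Λ X ∈ separableStates a' b'}

/-- The maximally entangled state `Ψ_m` on `ℂ^m ⊗ ℂ^m`. -/
def maxEntangled (m : ℕ) : Matrix (Fin m × Fin m) (Fin m × Fin m) ℂ :=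
  rankOne fun p => if p.1 = p.2 then ((1 / Real.sqrt m : ℝ) : ℂ) else 0

/-- The fidelity of distillation `sup ⟨Λ(ρ), Ψ_m⟩` over the operations `Λ` of the class. -/
def distillationFidelity (O : OpClass) {a b : ℕ}
    (ρ : Matrix (Fin a × Fin b) (Fin a × Fin b) ℂ) (m : ℕ) : ℝ :=
  sSup {x | ∃ Λ ∈ O.ops a b m m, x = (((Λ ρ)ᴴ * maxEntangled m).trace).re}

/-- The sizes `m ≥ 1` of maximally entangled states distillable within error `ε`. -/
def distillableSizes (O : OpClass) {a b : ℕ}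
    (ρ : Matrix (Fin a × Fin b) (Fin a × Fin b) ℂ) (ε : ℝ) : Set ℕ :=
  {m | 1 ≤ m ∧ 1 - ε ≤ distillationFidelity O ρ m}

/-- The one-shot `ε`-error distillable entanglement. -/
def distillableEntanglement (O : OpClass) {a b : ℕ}
    (ρ : Matrix (Fin a × Fin b) (Fin a × Fin b) ℂ) (ε : ℝ) : ℝ :=
  Real.logb 2 (sSup (distillableSizes O ρ ε) : ℕ)

/-- `ξ` is a vector of Schmidt coefficients of `ψ`. -/
def IsSchmidtVector {a b : ℕ} (ψ : EuclideanSpace ℂ (Fin a × Fin b))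
    (ξ : Fin (min a b) → ℝ) : Prop :=
  (∀ i, 0 ≤ ξ i) ∧
  ∃ (e : Fin (min a b) → EuclideanSpace ℂ (Fin a)) (f : Fin (min a b) → EuclideanSpace ℂ (Fin b)),
    Orthonormal ℂ e ∧ Orthonormal ℂ f ∧ ∀ p, ψ p = ∑ i, (ξ i : ℂ) * (e i p.1 * f i p.2)

/-- `log₂ ⌊2^x⌋`. -/
def logFloor (x : ℝ) : ℝ := Real.logb 2 (⌊(2 : ℝ) ^ x⌋ : ℤ)

/-- The feasible vectors `ω ∈ ℝ^d_+` with `⟨ξ, ω⟩ ≥ √(1 - ε)` and `‖ω‖₂ ≤ 1`. -/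
def feasibleVectors {d : ℕ} (ξ : Fin d → ℝ) (ε : ℝ) : Set (Fin d → ℝ) :=
  {ω | Real.sqrt (1 - ε) ≤ ξ ⬝ᵥ ω ∧ ‖WithLp.toLp 2 ω‖ ≤ 1 ∧ ∀ i, 0 ≤ ω i}

/-- A quadratically constrained linear program: minimise `c ⬝ x` over the real vectors `x` with
`x ⬝ P_k x + q_k ⬝ x + r_k ≤ 0` for all `k`. -/
structure QCLP (ι κ : Type) [Fintype ι] [Fintype κ] where
  c : ι → ℝ
  P : κ → Matrix ι ι ℝ
  q : κ → ι → ℝ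
  r : κ → ℝ

/-- The program is convex: all its quadratic forms are positive semidefinite. -/
def QCLP.IsConvex {ι κ : Type} [Fintype ι] [Fintype κ] (Q : QCLP ι κ) : Prop :=
  ∀ k, (Q.P k).PosSemidef

/-- The feasible set of the program. -/
def QCLP.feasible {ι κ : Type} [Fintype ι] [Fintype κ] (Q : QCLP ι κ) : Set (ι → ℝ) :=
  {x | ∀ k, x ⬝ᵥ (Q.P k *ᵥ x) + Q.q k ⬝ᵥ x + Q.r k ≤ 0}

/-- The program in the variables `(ω, s)`: minimise `s` subject to `ω i ^ 2 ≤ s` and `0 ≤ ω i` for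
all `i`, `∑ i, ω i ^ 2 ≤ 1` (the index `true`) and `√(1 - ε) ≤ ⟨ξ, ω⟩` (the index `false`). -/
def pureStateQCLP {d : ℕ} (ξ : Fin d → ℝ) (ε : ℝ) :
    QCLP (Fin d ⊕ Unit) (Fin d ⊕ Fin d ⊕ Bool) where
  c := Pi.single (Sum.inr ()) 1
  P
    | .inl i => Matrix.diagonal (Pi.single (Sum.inl i) 1)
    | .inr (.inl _) => 0
    | .inr (.inr true) => Matrix.diagonal (Sum.elim 1 0)
    | .inr (.inr false) => 0
  q
    | .inl _ => Pi.single (Sum.inr ()) (-1)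
    | .inr (.inl i) => Pi.single (Sum.inl i) (-1)
    | .inr (.inr true) => 0
    | .inr (.inr false) => Sum.elim (-ξ) 0
  r
    | .inl _ => 0
    | .inr (.inl _) => 0
    | .inr (.inr true) => -1
    | .inr (.inr false) => Real.sqrt (1 - ε)

end

/-! The fidelity of distillation of a pure state is `F_O(ψ, m) = max ⟨ξ, ω⟩²`, over the nonnegative
`ω` with `‖ω‖₂ ≤ 1` and `‖ω‖_∞² ≤ 1 / m`, for each of the six classes.

Upper bound: the operations of all classes map separable states into the Rains set, and states in
the Rains set have overlap at most `1 / m` with `Ψ_m`. The functional `X ↦ Tr(Λ(X) Ψ_m)` is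
`|x⟩⟨x| ↦ ‖T x‖²` for a contraction `T`, so that `‖T (e i ⊗ f i)‖² ≤ 1 / m` on the Schmidt
vectors. With `z = T ψ / ‖T ψ‖`, the vector `ω i = |⟨T (e i ⊗ f i), z⟩|` does the job.

Lower bound: the matrix with `m` equal columns `ω i ^ 2` is doubly substochastic, hence a mixture of
partial injections `σ` from the Schmidt indices to the `m` slots. Alice measures `σ`, with
amplitudes weighted by `1 / ω i`, and tells Bob, and both of them move the Schmidt vector `i` to the
slot `σ i`. Jensen's inequality for the mixture bounds the resulting fidelity from below by
`⟨ξ, ω⟩²`. -/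

noncomputable section

section PosSemidef

variable {n : Type*} [Fintype n]

theorem exists_eq_conjTranspose_mul_self_of_posSemidef {A : Matrix n n ℂ} (hA : A.PosSemidef) :
    ∃ B : Matrix n n ℂ, A = Bᴴ * B := by
  classical
  open scoped MatrixOrder in
  exact CStarAlgebra.nonneg_iff_eq_star_mul_self.1 (Matrix.nonneg_iff_posSemidef.2 hA)

theorem posSemidef_of_dotProduct_mulVec_nonneg {A : Matrix n n ℂ}
    (hA : ∀ x, 0 ≤ star x ⬝ᵥ (A *ᵥ x)) : A.PosSemidef := by
  classical
  rw [← Matrix.isPositive_toEuclideanLin_iff, LinearMap.isPositive_iff_complex]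
  intro x
  have h_inner : inner ℂ (Matrix.toEuclideanLin A x) x = star x.ofLp ⬝ᵥ (A *ᵥ x.ofLp) := by
    rw [← inner_conj_symm, EuclideanSpace.inner_eq_star_dotProduct, dotProduct_comm]
    exact (IsSelfAdjoint.of_nonneg (hA x.ofLp)).star_eq
  rw [h_inner]
  exact ⟨(Complex.eq_re_of_ofReal_le (hA _)).symm, (Complex.nonneg_iff.1 (hA _)).1⟩

theorem trace_mul_nonneg {A B : Matrix n n ℂ} (hA : A.PosSemidef) (hB : B.PosSemidef) :
    0 ≤ (A * B).trace := by
  obtain ⟨C, rfl⟩ := exists_eq_conjTranspose_mul_self_of_posSemidef hB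
  rw [← Matrix.mul_assoc, Matrix.trace_mul_comm, ← Matrix.mul_assoc]
  exact (hA.mul_mul_conjTranspose_same C).trace_nonneg

variable [DecidableEq n]

theorem abs_re_trace_mul_le_re_trace {P S : Matrix n n ℂ} (hP : P.PosSemidef)
    (hS_neg : (1 + S).PosSemidef) (hS_le : (1 - S).PosSemidef) :
    |(P * S).trace.re| ≤ P.trace.re := by
  have h_neg := (Complex.nonneg_iff.1 (trace_mul_nonneg hP hS_neg)).1
  have h_le := (Complex.nonneg_iff.1 (trace_mul_nonneg hP hS_le)).1
  simp only [Matrix.mul_add, Matrix.mul_sub, Matrix.mul_one, Matrix.trace_add, Matrix.trace_sub,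
    Complex.add_re, Complex.sub_re] at h_neg h_le
  exact abs_le.2 ⟨by linarith, by linarith⟩

theorem posSemidef_one_add_of_mul_self_eq_one {S : Matrix n n ℂ} (hS : S.IsHermitian)
    (hSS : S * S = 1) : (1 + S).PosSemidef := by
  have h_sq : 1 + S = (1 / 2 : ℝ) • ((1 + S)ᴴ * (1 + S)) := by
    simp only [(Matrix.isHermitian_one.add hS).eq, mul_add, add_mul, mul_one, one_mul, hSS]
    module
  rw [h_sq]
  exact (Matrix.posSemidef_conjTranspose_mul_self _).smul (by positivity)

theorem posSemidef_one_sub_of_mul_self_eq_one {S : Matrix n n ℂ} (hS : S.IsHermitian)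
    (hSS : S * S = 1) : (1 - S).PosSemidef := by
  rw [sub_eq_add_neg]
  exact posSemidef_one_add_of_mul_self_eq_one hS.neg (by rw [neg_mul_neg, hSS])

end PosSemidef

section TraceNorm

open scoped MatrixOrder

variable {n : Type} [Fintype n] [DecidableEq n]

theorem trace_cfc_eq_sum_eigenvalues {A : Matrix n n ℂ} (hA : A.IsHermitian) (f : ℝ → ℝ) :
    (cfc f A).trace = ∑ i, (f (hA.eigenvalues i) : ℂ) := by
  rw [hA.cfc_eq, Matrix.IsHermitian.cfc, Unitary.conjStarAlgAut_apply, Matrix.trace_mul_cycle,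
    Unitary.coe_star_mul_self, Matrix.one_mul, Matrix.trace_diagonal]
  rfl

theorem traceNorm_eq_trace_abs (X : Matrix n n ℂ) : (traceNorm X : ℂ) = (CFC.abs X).trace := by
  rw [CFC.abs, CFC.sqrt_eq_real_sqrt _ (star_mul_self_nonneg X), cfcₙ_eq_cfc,
    Matrix.star_eq_conjTranspose,
    trace_cfc_eq_sum_eigenvalues (Matrix.isHermitian_conjTranspose_mul_self X), traceNorm,
    Complex.ofReal_sum]

theorem traceNorm_eq_trace {A : Matrix n n ℂ} (hA : A.PosSemidef) :
    (traceNorm A : ℂ) = A.trace := by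
  rw [traceNorm_eq_trace_abs, CFC.abs_of_nonneg A (Matrix.nonneg_iff_posSemidef.2 hA)]

theorem exists_posSemidef_sub_eq {A : Matrix n n ℂ} (hA : A.IsHermitian) :
    ∃ P N : Matrix n n ℂ, P.PosSemidef ∧ N.PosSemidef ∧ A = P - N ∧
      P.trace + N.trace = traceNorm A := by
  refine ⟨A⁺, A⁻, Matrix.nonneg_iff_posSemidef.1 (CFC.posPart_nonneg A),
    Matrix.nonneg_iff_posSemidef.1 (CFC.negPart_nonneg A),
    (CFC.posPart_sub_negPart A hA.isSelfAdjoint).symm, ?_⟩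
  rw [← Matrix.trace_add, CFC.posPart_add_negPart A hA.isSelfAdjoint, traceNorm_eq_trace_abs]

theorem abs_re_trace_mul_le_traceNorm {A S : Matrix n n ℂ} (hA : A.IsHermitian)
    (hS_neg : (1 + S).PosSemidef) (hS_le : (1 - S).PosSemidef) :
    |(A * S).trace.re| ≤ traceNorm A := by
  obtain ⟨P, N, hP, hN, rfl, hPN⟩ := exists_posSemidef_sub_eq hA
  rw [← Complex.ofReal_re (traceNorm _), ← hPN, Matrix.sub_mul, Matrix.trace_sub, Complex.sub_re,
    Complex.add_re]
  exact (abs_sub _ _).trans (add_le_add (abs_re_trace_mul_le_re_trace hP hS_neg hS_le)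
    (abs_re_trace_mul_le_re_trace hN hS_neg hS_le))

theorem exists_re_trace_mul_eq_traceNorm {A : Matrix n n ℂ} (hA : A.IsHermitian) :
    ∃ S : Matrix n n ℂ, (1 + S).PosSemidef ∧ (1 - S).PosSemidef ∧
      (A * S).trace.re = traceNorm A := by
  have h_cont (f : ℝ → ℝ) : ContinuousOn f (spectrum ℝ A) := A.finite_real_spectrum.continuousOn f
  have h_neg_one_le (x : ℝ) : -1 ≤ (SignType.sign x : ℝ) := by
    rcases lt_trichotomy x 0 with hx | rfl | hx <;> simp [*]
  have h_le_one (x : ℝ) : (SignType.sign x : ℝ) ≤ 1 := by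
    rcases lt_trichotomy x 0 with hx | rfl | hx <;> simp [*]
  refine ⟨cfc (fun x : ℝ => (SignType.sign x : ℝ)) A, ?_, ?_, ?_⟩
  · have h := algebraMap_le_cfc _ (-1) A (fun x _ => h_neg_one_le x) (h_cont _) hA.isSelfAdjoint
    rwa [Matrix.le_iff, map_neg, map_one, sub_neg_eq_add, add_comm] at h
  · exact Matrix.le_iff.1 (cfc_le_one _ A fun x _ => h_le_one x)
  · have h_mul := cfc_mul (fun x : ℝ => x) (fun x : ℝ => (SignType.sign x : ℝ)) A (h_cont _)
      (h_cont _)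
    rw [cfc_id' ℝ A hA.isSelfAdjoint] at h_mul
    simp_rw [← h_mul, self_mul_sign, ← Real.norm_eq_abs]
    rw [← CFC.abs_eq_cfc_norm A hA.isSelfAdjoint, ← traceNorm_eq_trace_abs, Complex.ofReal_re]

theorem traceNorm_sub_le {P N : Matrix n n ℂ} (hP : P.PosSemidef) (hN : N.PosSemidef) :
    traceNorm (P - N) ≤ (P.trace + N.trace).re := by
  obtain ⟨S, hS_neg, hS_le, hS⟩ := exists_re_trace_mul_eq_traceNorm (hP.1.sub hN.1)
  have hPS := abs_le.1 (abs_re_trace_mul_le_re_trace hP hS_neg hS_le)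
  have hNS := abs_le.1 (abs_re_trace_mul_le_re_trace hN hS_neg hS_le)
  rw [← hS, Matrix.sub_mul, Matrix.trace_sub, Complex.sub_re, Complex.add_re]
  linarith

end TraceNorm

section RankOne

variable {n : Type}

theorem posSemidef_rankOne [Finite n] (x : n → ℂ) : (rankOne x).PosSemidef :=
  Matrix.posSemidef_vecMulVec_self_star x

variable [Fintype n]

theorem trace_mul_rankOne (A : Matrix n n ℂ) (x : n → ℂ) :
    (A * rankOne x).trace = star x ⬝ᵥ (A *ᵥ x) := by
  rw [rankOne, Matrix.mul_vecMulVec, Matrix.trace_vecMulVec, dotProduct_comm]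

theorem trace_rankOne (x : EuclideanSpace ℂ n) : (rankOne x.ofLp).trace = (‖x‖ ^ 2 : ℝ) := by
  rw [rankOne, Matrix.trace_vecMulVec, ← EuclideanSpace.inner_eq_star_dotProduct,
    inner_self_eq_norm_sq_to_K]
  norm_cast

theorem mul_rankOne_mul_conjTranspose {k : Type} (K : Matrix k n ℂ) (x : n → ℂ) :
    K * rankOne x * Kᴴ = rankOne (K *ᵥ x) := by
  rw [rankOne, rankOne, Matrix.mul_vecMulVec, Matrix.vecMulVec_mul, ← Matrix.star_mulVec]

end RankOne

section Kronecker

open scoped Kronecker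

variable {a a' b b' n k l : Type}

theorem linearMap_ext_kronecker [Finite a] [Finite b] {M : Type*} [AddCommMonoid M] [Module ℂ M]
    {f g : Matrix (a × b) (a × b) ℂ →ₗ[ℂ] M} (h : ∀ A B, f (A ⊗ₖ B) = g (A ⊗ₖ B)) : f = g := by
  classical
  refine Matrix.ext_linearMap ℂ fun p q => LinearMap.ext_ring ?_
  have hpq := h (Matrix.single p.1 q.1 1) (Matrix.single p.2 q.2 1)
  rwa [Matrix.single_kronecker_single, one_mul] at hpq

theorem partialTranspose_kronecker (A : Matrix a a ℂ) (B : Matrix b b ℂ) :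
    partialTranspose a b (A ⊗ₖ B) = A ⊗ₖ Bᵀ := rfl

theorem trace_partialTranspose [Fintype a] [Fintype b] (X : Matrix (a × b) (a × b) ℂ) :
    (partialTranspose a b X).trace = X.trace := rfl

theorem isHermitian_partialTranspose {X : Matrix (a × b) (a × b) ℂ} (hX : X.IsHermitian) :
    (partialTranspose a b X).IsHermitian :=
  Matrix.IsHermitian.ext fun p q => hX.apply (p.1, q.2) (q.1, p.2)

namespace SuperOp

theorem onLeft_kronecker (E : SuperOp a a') (A : Matrix a a ℂ) (B : Matrix b b ℂ) :
    E.onLeft b (A ⊗ₖ B) = E A ⊗ₖ B := by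
  ext p q
  have h_slice : (Matrix.of fun i j => (A ⊗ₖ B) (i, p.2) (j, q.2)) = B p.2 q.2 • A := by
    ext i j
    exact mul_comm _ _
  change E (Matrix.of fun i j => (A ⊗ₖ B) (i, p.2) (j, q.2)) p.1 q.1 = E A p.1 q.1 * B p.2 q.2
  rw [h_slice, map_smul, Matrix.smul_apply, smul_eq_mul, mul_comm]

theorem onRight_kronecker (D : SuperOp b b') (A : Matrix a a ℂ) (B : Matrix b b ℂ) :
    D.onRight a (A ⊗ₖ B) = A ⊗ₖ D B := by
  ext p q
  have h_slice : (Matrix.of fun i j => (A ⊗ₖ B) (p.1, i) (q.1, j)) = A p.1 q.1 • B := rfl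
  change D (Matrix.of fun i j => (A ⊗ₖ B) (p.1, i) (q.1, j)) p.2 q.2 = A p.1 q.1 * D B p.2 q.2
  rw [h_slice, map_smul, Matrix.smul_apply, smul_eq_mul]

theorem tensor_kronecker (E : SuperOp a a') (D : SuperOp b b') (A : Matrix a a ℂ)
    (B : Matrix b b ℂ) : E.tensor D (A ⊗ₖ B) = E A ⊗ₖ D B := by
  rw [tensor, LinearMap.comp_apply, onRight_kronecker, onLeft_kronecker]

theorem tensor_eq_comp [Finite a] [Finite b] (E : SuperOp a a') (D : SuperOp b b') :
    E.tensor D = (D.onRight a').comp (E.onLeft b) :=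
  linearMap_ext_kronecker fun A B => by
    rw [tensor_kronecker, LinearMap.comp_apply, onLeft_kronecker, onRight_kronecker]

theorem tensor_add_right (E : SuperOp a a') (D D' : SuperOp b b') :
    E.tensor (D + D') = E.tensor D + E.tensor D' :=
  LinearMap.comp_add (f := D.onRight a) (g := D'.onRight a) (E.onLeft b')

theorem sum_trace_onLeft {ι : Type*} [Fintype ι] [Fintype a] [Fintype b] {k : ι → Type}
    [∀ j, Fintype (k j)] {E : ∀ j, SuperOp a (k j)} (hE : ∀ X, ∑ j, (E j X).trace = X.trace)
    (X : Matrix (a × b) (a × b) ℂ) : ∑ j, ((E j).onLeft b X).trace = X.trace := by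
  have h_eq : ∑ j, Matrix.traceLinearMap (k j × b) ℂ ℂ ∘ₗ (E j).onLeft b =
      Matrix.traceLinearMap (a × b) ℂ ℂ := linearMap_ext_kronecker fun A B => by
    simp only [LinearMap.sum_apply, LinearMap.comp_apply, Matrix.traceLinearMap_apply,
      onLeft_kronecker, Matrix.trace_kronecker, ← Finset.sum_mul, hE]
  simpa only [LinearMap.sum_apply, LinearMap.comp_apply, Matrix.traceLinearMap_apply] using
    LinearMap.congr_fun h_eq X

theorem sum_trace_onRight {ι : Type*} [Fintype ι] [Fintype a] [Fintype b] {k : ι → Type}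
    [∀ j, Fintype (k j)] {D : ∀ j, SuperOp b (k j)} (hD : ∀ X, ∑ j, (D j X).trace = X.trace)
    (X : Matrix (a × b) (a × b) ℂ) : ∑ j, ((D j).onRight a X).trace = X.trace := by
  have h_eq : ∑ j, Matrix.traceLinearMap (a × k j) ℂ ℂ ∘ₗ (D j).onRight a =
      Matrix.traceLinearMap (a × b) ℂ ℂ := linearMap_ext_kronecker fun A B => by
    simp only [LinearMap.sum_apply, LinearMap.comp_apply, Matrix.traceLinearMap_apply,
      onRight_kronecker, Matrix.trace_kronecker, ← Finset.mul_sum, hD]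
  simpa only [LinearMap.sum_apply, LinearMap.comp_apply, Matrix.traceLinearMap_apply] using
    LinearMap.congr_fun h_eq X

/-- Conjugation `X ↦ K X Kᴴ` by a matrix `K`: the completely positive maps with a single Kraus
operator. -/
def conj [Fintype n] (K : Matrix k n ℂ) : SuperOp n k where
  toFun X := K * X * Kᴴ
  map_add' X Y := by rw [Matrix.mul_add, Matrix.add_mul]
  map_smul' z X := by simp only [Matrix.mul_smul, Matrix.smul_mul, RingHom.id_apply]

theorem conj_apply [Fintype n] (K : Matrix k n ℂ) (X : Matrix n n ℂ) :
    conj K X = K * X * Kᴴ := rfl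

theorem conj_tensor_conj [Fintype a] [Fintype b] (K : Matrix a' a ℂ) (V : Matrix b' b ℂ) :
    (conj K).tensor (conj V) = conj (K ⊗ₖ V) :=
  linearMap_ext_kronecker fun A B => by
    rw [tensor_kronecker, conj_apply, conj_apply, conj_apply, Matrix.conjTranspose_kronecker,
      ← Matrix.mul_kronecker_mul, ← Matrix.mul_kronecker_mul]

theorem conj_onRight [Fintype a] [DecidableEq a] [Fintype b] (K : Matrix b' b ℂ) :
    (conj K).onRight a = conj ((1 : Matrix a a ℂ) ⊗ₖ K) :=
  linearMap_ext_kronecker fun A B => by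
    rw [onRight_kronecker, conj_apply, conj_apply, Matrix.conjTranspose_kronecker,
      ← Matrix.mul_kronecker_mul, ← Matrix.mul_kronecker_mul, Matrix.conjTranspose_one,
      Matrix.one_mul, Matrix.mul_one]

theorem isCP_conj [Fintype n] [Finite k] (K : Matrix k n ℂ) : (conj K).IsCP := fun r X hX => by
  rw [conj_onRight, conj_apply]
  exact hX.mul_mul_conjTranspose_same _

theorem isCP_id : SuperOp.IsCP (LinearMap.id : SuperOp n n) := fun _ _ hX => hX

theorem IsCP.posSemidef_onRight {Λ : SuperOp n k} (hΛ : Λ.IsCP) {r : Type} [Finite r]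
    {X : Matrix (r × n) (r × n) ℂ} (hX : X.PosSemidef) : (Λ.onRight r X).PosSemidef := by
  have e := Finite.equivFin r
  convert (hΛ _ _ (hX.submatrix (Prod.map e.symm id))).submatrix (Prod.map e id) using 1
  ext p q
  change Λ _ _ _ = Λ _ _ _
  simp only [Matrix.submatrix_apply, Prod.map_fst, Prod.map_snd, Prod.map_apply,
    Equiv.symm_apply_apply, id]

theorem IsCP.posSemidef {Λ : SuperOp n k} (hΛ : Λ.IsCP) {X : Matrix n n ℂ} (hX : X.PosSemidef) :
    (Λ X).PosSemidef :=
  (hΛ.posSemidef_onRight (r := Unit) (hX.submatrix Prod.snd)).submatrix fun i => ((), i)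

theorem IsCP.onRight [Finite a] {D : SuperOp b b'} (hD : D.IsCP) : (D.onRight a).IsCP :=
  fun r _ hX => (hD.posSemidef_onRight (hX.submatrix (Equiv.prodAssoc (Fin r) a b))).submatrix
    (Equiv.prodAssoc (Fin r) a b').symm

theorem IsCP.onLeft [Finite b] {E : SuperOp a a'} (hE : E.IsCP) : (E.onLeft b).IsCP :=
  fun r _ hX => (hE.posSemidef_onRight (r := Fin r × b)
    (hX.submatrix fun p : (Fin r × b) × a => (p.1.1, (p.2, p.1.2)))).submatrix
    fun p : Fin r × (a' × b) => ((p.1, p.2.2), p.2.1)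

theorem IsCP.comp {Λ : SuperOp k l} {Φ : SuperOp n k} (hΛ : Λ.IsCP) (hΦ : Φ.IsCP) :
    SuperOp.IsCP (LinearMap.comp Λ Φ) :=
  fun r X hX => hΛ r _ (hΦ r X hX)

theorem IsCP.tensor [Finite a] [Finite b'] {E : SuperOp a a'} {D : SuperOp b b'} (hE : E.IsCP)
    (hD : D.IsCP) : (E.tensor D).IsCP :=
  hE.onLeft.comp hD.onRight

theorem IsCP.zero : SuperOp.IsCP (0 : SuperOp n k) := fun _ _ _ => Matrix.PosSemidef.zero

theorem IsCP.add {Λ Φ : SuperOp n k} (hΛ : Λ.IsCP) (hΦ : Φ.IsCP) : SuperOp.IsCP (Λ + Φ) :=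
  fun r X hX => (hΛ r X hX).add (hΦ r X hX)

theorem IsCP.sum {ι : Type*} {s : Finset ι} {Λ : ι → SuperOp n k} (hΛ : ∀ i ∈ s, (Λ i).IsCP) :
    SuperOp.IsCP (∑ i ∈ s, Λ i) :=
  Finset.sum_induction _ SuperOp.IsCP (fun _ _ => IsCP.add) IsCP.zero hΛ

/-- The map `X ↦ (D Xᵀ)ᵀ`, the conjugate of `D` by the transposition. -/
def transposed (D : SuperOp b b') : SuperOp b b' where
  toFun X := (D Xᵀ)ᵀ
  map_add' X Y := by rw [Matrix.transpose_add, map_add, Matrix.transpose_add]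
  map_smul' z X := by rw [Matrix.transpose_smul, map_smul, Matrix.transpose_smul, RingHom.id_apply]

theorem IsCP.transposed {D : SuperOp b b'} (hD : D.IsCP) : D.transposed.IsCP :=
  fun r _ hX => (hD r _ hX.transpose).transpose

/-- The conjugate of `Λ` by the partial transposes of its input and output; the PPT maps are those
for which it is completely positive. -/
def ptConj (Λ : SuperOp (a × b) (a' × b')) : SuperOp (a × b) (a' × b') :=
  (partialTranspose a' b').comp (Λ.comp (partialTranspose a b))

theorem ptConj_sum {ι : Type*} (s : Finset ι) (Λ : ι → SuperOp (a × b) (a' × b')) :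
    ptConj (∑ i ∈ s, Λ i) = ∑ i ∈ s, (Λ i).ptConj := by
  ext X : 1
  simp only [ptConj, LinearMap.comp_apply, LinearMap.sum_apply, map_sum]

theorem ptConj_comp_onLeft (Λ : SuperOp (k × b) (a' × b')) (E : SuperOp a k) :
    ptConj (Λ.comp (E.onLeft b)) = Λ.ptConj.comp (E.onLeft b) := rfl

theorem ptConj_comp_onRight (Λ : SuperOp (a × k) (a' × b')) (D : SuperOp b k) :
    ptConj (Λ.comp (D.onRight a)) = Λ.ptConj.comp (D.transposed.onRight a) := rfl

theorem ptConj_tensor (E : SuperOp a a') (D : SuperOp b b') :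
    (E.tensor D).ptConj = E.tensor D.transposed := rfl

theorem partialTranspose_apply_eq_ptConj (Λ : SuperOp (a × b) (a' × b'))
    (X : Matrix (a × b) (a × b) ℂ) :
    partialTranspose a' b' (Λ X) = Λ.ptConj (partialTranspose a b X) := rfl

theorem IsCPTP.tensor [Fintype a] [Fintype a'] [Fintype b] [Fintype b'] {E : SuperOp a a'}
    {D : SuperOp b b'} (hE : E.IsCPTP) (hD : D.IsCPTP) : (E.tensor D).IsCPTP := by
  refine ⟨hE.1.tensor hD.1, fun X => ?_⟩
  have h_eq : Matrix.traceLinearMap (a' × b') ℂ ℂ ∘ₗ E.tensor D =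
      Matrix.traceLinearMap (a × b) ℂ ℂ := linearMap_ext_kronecker fun A B => by
    simp only [LinearMap.comp_apply, Matrix.traceLinearMap_apply, tensor_kronecker,
      Matrix.trace_kronecker, hE.2, hD.2]
  exact LinearMap.congr_fun h_eq X

end SuperOp

end Kronecker

section LOCC

variable {a b a' b' : ℕ} {Λ : SuperOp (Fin a × Fin b) (Fin a' × Fin b')}

theorem IsOneWayLOCC.isLOCC (hΛ : IsOneWayLOCC Λ) : IsLOCC Λ := by
  obtain ⟨N, E, D, hE, hD, rfl⟩ := hΛ
  have h_tensor (j : Fin N) : (E j).tensor (D j) =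
      LinearMap.comp (SuperOp.tensor (LinearMap.id : SuperOp (Fin a') (Fin a')) (D j))
        ((E j).onLeft (Fin b)) :=
    (E j).tensor_eq_comp (D j)
  simp_rw [h_tensor]
  exact IsLOCC.alice (fun _ => a') E _ hE fun j =>
    IsLOCC.localOps _ _ ⟨SuperOp.isCP_id, fun _ => rfl⟩ (hD j)

theorem IsLOCC.isCPTP (hΛ : IsLOCC Λ) : Λ.IsCPTP := by
  induction hΛ with
  | localOps E D hE hD => exact hE.tensor hD
  | alice c E Λ hE _ ih =>
    refine ⟨SuperOp.IsCP.sum fun j _ => (ih j).1.comp (hE.1 j).onLeft, fun X => ?_⟩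
    rw [LinearMap.sum_apply, Matrix.trace_sum, ← SuperOp.sum_trace_onLeft hE.2 X]
    exact Finset.sum_congr rfl fun j _ => (ih j).2 _
  | bob c D Λ hD _ ih =>
    refine ⟨SuperOp.IsCP.sum fun j _ => (ih j).1.comp (hD.1 j).onRight, fun X => ?_⟩
    rw [LinearMap.sum_apply, Matrix.trace_sum, ← SuperOp.sum_trace_onRight hD.2 X]
    exact Finset.sum_congr rfl fun j _ => (ih j).2 _

theorem IsLOCC.isCP_ptConj (hΛ : IsLOCC Λ) : Λ.ptConj.IsCP := by
  induction hΛ with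
  | localOps E D hE hD =>
    rw [SuperOp.ptConj_tensor]
    exact hE.1.tensor hD.1.transposed
  | alice c E Λ hE _ ih =>
    rw [SuperOp.ptConj_sum]
    simp_rw [SuperOp.ptConj_comp_onLeft]
    exact SuperOp.IsCP.sum fun j _ => (ih j).comp (hE.1 j).onLeft
  | bob c D Λ hD _ ih =>
    rw [SuperOp.ptConj_sum]
    simp_rw [SuperOp.ptConj_comp_onRight]
    exact SuperOp.IsCP.sum fun j _ => (ih j).comp (hD.1 j).transposed.onRight

theorem IsLOCC.mem_ops_PPT (hΛ : IsLOCC Λ) : Λ ∈ OpClass.PPT.ops a b a' b' :=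
  ⟨hΛ.isCPTP, hΛ.isCP_ptConj⟩

theorem OpClass.ops_PPT_subset_pptPreserving :
    OpClass.PPT.ops a b a' b' ⊆ OpClass.pptPreserving.ops a b a' b' :=
  fun _ ⟨hΛ, hΛ_pt⟩ => ⟨hΛ, fun X ⟨hX_tr, hX, hX_pt⟩ =>
    ⟨(hΛ.2 X).trans hX_tr, hΛ.1.posSemidef hX, SuperOp.IsCP.posSemidef hΛ_pt hX_pt⟩⟩

theorem traceNorm_partialTranspose_apply_le (hΛ : Λ.IsCPTP) (hΛ_pt : Λ.ptConj.IsCP)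
    {X : Matrix (Fin a × Fin b) (Fin a × Fin b) ℂ} (hX : X.IsHermitian) :
    traceNorm (partialTranspose (Fin a') (Fin b') (Λ X)) ≤
      traceNorm (partialTranspose (Fin a) (Fin b) X) := by
  obtain ⟨P, N, hP, hN, hPN, h_trace⟩ := exists_posSemidef_sub_eq (isHermitian_partialTranspose hX)
  have h_tp (Y : Matrix (Fin a × Fin b) (Fin a × Fin b) ℂ) : (Λ.ptConj Y).trace = Y.trace := hΛ.2 _
  rw [SuperOp.partialTranspose_apply_eq_ptConj, hPN, map_sub]
  refine (traceNorm_sub_le (hΛ_pt.posSemidef hP) (hΛ_pt.posSemidef hN)).trans_eq ?_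
  rw [h_tp, h_tp, h_trace, Complex.ofReal_re, hPN]

theorem OpClass.ops_PPT_subset_rainsPreserving :
    OpClass.PPT.ops a b a' b' ⊆ OpClass.rainsPreserving.ops a b a' b' :=
  fun _ ⟨hΛ, hΛ_pt⟩ => ⟨hΛ, fun _ ⟨hX, hX_norm⟩ =>
    ⟨hΛ.1.posSemidef hX, (traceNorm_partialTranspose_apply_le hΛ hΛ_pt hX.1).trans hX_norm⟩⟩

end LOCC

section Separable

open scoped Kronecker

theorem mem_convexHull_of_mem_hull {E : Type*} [AddCommGroup E] [Module ℝ E] {S : Set E}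
    {f : E →ₗ[ℝ] ℝ} (hf : ∀ y ∈ S, f y = 1) {x : E} (hx : x ∈ PointedCone.hull ℝ S)
    (hfx : f x = 1) : x ∈ convexHull ℝ S := by
  obtain ⟨c, hcS, hc, rfl⟩ := PointedCone.mem_hull_set.1 hx
  rw [Finsupp.sum, map_sum] at hfx
  refine (convex_convexHull ℝ S).sum_mem (fun y _ => hc y) ?_
    fun y hy => subset_convexHull ℝ S (hcS hy)
  rw [← hfx]
  exact Finset.sum_congr rfl fun y hy => by rw [map_smul, hf y (hcS hy), smul_eq_mul, mul_one]

theorem exists_eq_sum_smul_rankOne {n : Type} [Fintype n] {A : Matrix n n ℂ} (hA : A.PosSemidef) :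
    ∃ (t : n → ℝ) (φ : n → EuclideanSpace ℂ n), (∀ i, 0 ≤ t i) ∧ (∀ i, ‖φ i‖ = 1) ∧
      A = ∑ i, t i • rankOne (φ i).ofLp := by
  classical
  refine ⟨hA.1.eigenvalues, hA.1.eigenvectorBasis, hA.eigenvalues_nonneg,
    hA.1.eigenvectorBasis.orthonormal.1, ?_⟩
  conv_lhs => rw [hA.1.spectral_theorem, Unitary.conjStarAlgAut_apply]
  ext i j
  rw [Matrix.mul_apply, Matrix.sum_apply]
  refine Finset.sum_congr rfl fun k _ => ?_
  rw [Matrix.mul_diagonal, mul_comm (hA.1.eigenvectorUnitary i k : ℂ), mul_assoc]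
  exact (Complex.real_smul ..).symm

theorem rankOne_mul {a b : Type} (φ : a → ℂ) (η : b → ℂ) :
    rankOne (fun p : a × b => φ p.1 * η p.2) = rankOne φ ⊗ₖ rankOne η := by
  ext p q
  change φ p.1 * η p.2 * star (φ q.1 * η q.2) = φ p.1 * star (φ q.1) * (η p.2 * star (η q.2))
  rw [star_mul', mul_mul_mul_comm]

/-- The cone of unnormalised separable operators: the nonnegative combinations of the products of
positive semidefinite matrices. -/
def separableCone (a b : Type) : PointedCone ℝ (Matrix (a × b) (a × b) ℂ) :=
  PointedCone.hull ℝ {X | ∃ (A : Matrix a a ℂ) (B : Matrix b b ℂ),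
    A.PosSemidef ∧ B.PosSemidef ∧ X = A ⊗ₖ B}

theorem kronecker_mem_separableCone {a b : Type} {A : Matrix a a ℂ} {B : Matrix b b ℂ}
    (hA : A.PosSemidef) (hB : B.PosSemidef) : A ⊗ₖ B ∈ separableCone a b :=
  PointedCone.subset_hull ⟨A, B, hA, hB, rfl⟩

theorem apply_mem_of_mem_separableCone {a b : Type} {M : Type*} [AddCommGroup M] [Module ℂ M]
    {f : Matrix (a × b) (a × b) ℂ →ₗ[ℂ] M} {C : PointedCone ℝ M}
    (hf : ∀ (A : Matrix a a ℂ) (B : Matrix b b ℂ), A.PosSemidef → B.PosSemidef → f (A ⊗ₖ B) ∈ C)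
    {X : Matrix (a × b) (a × b) ℂ} (hX : X ∈ separableCone a b) : f X ∈ C := by
  refine Submodule.span_induction (p := fun Y _ => f Y ∈ C) ?_ ?_ ?_ ?_ hX
  · rintro _ ⟨A, B, hA, hB, rfl⟩
    exact hf A B hA hB
  · rw [map_zero]
    exact C.zero_mem
  · intro Y Z _ _ hY hZ
    rw [map_add]
    exact C.add_mem hY hZ
  · intro t Y _ hY
    rw [f.map_smul_of_tower]
    exact Submodule.smul_mem C t hY

theorem hull_product_states (a b : ℕ) :
    PointedCone.hull ℝ {X | ∃ (φ : EuclideanSpace ℂ (Fin a)) (η : EuclideanSpace ℂ (Fin b)),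
      ‖φ‖ = 1 ∧ ‖η‖ = 1 ∧ X = rankOne fun p => φ p.1 * η p.2} = separableCone (Fin a) (Fin b) := by
  refine le_antisymm (Submodule.span_le.2 ?_) (Submodule.span_le.2 ?_)
  · rintro _ ⟨φ, η, -, -, rfl⟩
    rw [rankOne_mul]
    exact kronecker_mem_separableCone (posSemidef_rankOne φ.ofLp) (posSemidef_rankOne η.ofLp)
  · rintro _ ⟨A, B, hA, hB, rfl⟩
    obtain ⟨s, φ, hs, hφ, rfl⟩ := exists_eq_sum_smul_rankOne hA
    obtain ⟨t, η, ht, hη, rfl⟩ := exists_eq_sum_smul_rankOne hB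
    change Matrix.kroneckerBilinear (R := ℝ) _ _ ∈ PointedCone.hull ℝ _
    simp only [map_sum, map_smul, LinearMap.sum_apply, LinearMap.smul_apply]
    refine Submodule.sum_mem _ fun j _ => PointedCone.smul_mem _ (ht j) <|
      Submodule.sum_mem _ fun i _ => PointedCone.smul_mem _ (hs i) <|
        PointedCone.subset_hull ⟨φ i, η j, hφ i, hη j, (rankOne_mul _ _).symm⟩

open scoped MatrixOrder

theorem posSemidef_of_mem_separableCone {a b k : Type} [Finite k]
    {f : SuperOp (a × b) k}
    (hf : ∀ (A : Matrix a a ℂ) (B : Matrix b b ℂ), A.PosSemidef → B.PosSemidef →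
      (f (A ⊗ₖ B)).PosSemidef) {X : Matrix (a × b) (a × b) ℂ} (hX : X ∈ separableCone a b) :
    (f X).PosSemidef := by
  have := Fintype.ofFinite k
  exact Matrix.nonneg_iff_posSemidef.1 <| apply_mem_of_mem_separableCone
    (C := PointedCone.positive ℝ (Matrix k k ℂ)) (fun A B hA hB => (hf A B hA hB).nonneg) hX

variable {a b a' b' : ℕ}

theorem mem_separableStates_iff {X : Matrix (Fin a × Fin b) (Fin a × Fin b) ℂ} :
    X ∈ separableStates a b ↔ X ∈ separableCone (Fin a) (Fin b) ∧ X.trace = 1 := by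
  have h_trace {φ : EuclideanSpace ℂ (Fin a)} {η : EuclideanSpace ℂ (Fin b)} (hφ : ‖φ‖ = 1)
      (hη : ‖η‖ = 1) : (rankOne fun p : Fin a × Fin b => φ p.1 * η p.2).trace = 1 := by
    simp [rankOne_mul, Matrix.trace_kronecker, trace_rankOne, hφ, hη]
  constructor
  · refine fun hX => ⟨?_, ?_⟩
    · rw [← hull_product_states]
      exact convexHull_min PointedCone.subset_hull (PointedCone.convex _) hX
    · refine convexHull_min ?_
        ((convex_singleton (1 : ℂ)).linear_preimage (Matrix.traceLinearMap _ ℝ ℂ)) hX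
      rintro _ ⟨φ, η, hφ, hη, rfl⟩
      exact h_trace hφ hη
  · rintro ⟨hX, hX_trace⟩
    rw [← hull_product_states] at hX
    refine mem_convexHull_of_mem_hull
      (f := Complex.reLm ∘ₗ Matrix.traceLinearMap _ ℝ ℂ) ?_ hX ?_
    · rintro _ ⟨φ, η, hφ, hη, rfl⟩
      simp [h_trace hφ hη]
    · simp [hX_trace]

theorem separableStates_subset_pptStates : separableStates a b ⊆ pptStates a b := fun X hX => by
  obtain ⟨hX, hX_trace⟩ := mem_separableStates_iff.1 hX
  refine ⟨hX_trace, ?_, ?_⟩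
  · exact posSemidef_of_mem_separableCone (f := LinearMap.id)
      (fun A B hA hB => hA.kronecker hB) hX
  · refine posSemidef_of_mem_separableCone (fun A B hA hB => ?_) hX
    rw [partialTranspose_kronecker]
    exact hA.kronecker hB.transpose

theorem pptStates_subset_rainsSet : pptStates a b ⊆ rainsSet a b := by
  rintro X ⟨hX_trace, hX, hX_pt⟩
  have h_norm := traceNorm_eq_trace hX_pt
  rw [trace_partialTranspose, hX_trace] at h_norm
  exact ⟨hX, by exact_mod_cast h_norm.le⟩

theorem IsLOCC.apply_mem_separableCone {Λ : SuperOp (Fin a × Fin b) (Fin a' × Fin b')}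
    (hΛ : IsLOCC Λ) {X : Matrix (Fin a × Fin b) (Fin a × Fin b) ℂ}
    (hX : X ∈ separableCone (Fin a) (Fin b)) : Λ X ∈ separableCone (Fin a') (Fin b') := by
  induction hΛ with
  | localOps E D hE hD =>
    refine apply_mem_of_mem_separableCone (fun A B hA hB => ?_) hX
    rw [SuperOp.tensor_kronecker]
    exact kronecker_mem_separableCone (hE.1.posSemidef hA) (hD.1.posSemidef hB)
  | alice c E Λ hE _ ih =>
    rw [LinearMap.sum_apply]
    refine Submodule.sum_mem _ fun j _ =>
      ih j (apply_mem_of_mem_separableCone (fun A B hA hB => ?_) hX)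
    rw [SuperOp.onLeft_kronecker]
    exact kronecker_mem_separableCone ((hE.1 j).posSemidef hA) hB
  | bob c D Λ hD _ ih =>
    rw [LinearMap.sum_apply]
    refine Submodule.sum_mem _ fun j _ =>
      ih j (apply_mem_of_mem_separableCone (fun A B hA hB => ?_) hX)
    rw [SuperOp.onRight_kronecker]
    exact kronecker_mem_separableCone hA ((hD.1 j).posSemidef hB)

theorem IsLOCC.mem_ops_separabilityPreserving {Λ : SuperOp (Fin a × Fin b) (Fin a' × Fin b')}
    (hΛ : IsLOCC Λ) : Λ ∈ OpClass.separabilityPreserving.ops a b a' b' := by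
  refine ⟨hΛ.isCPTP, fun X hX => ?_⟩
  rw [mem_separableStates_iff] at hX ⊢
  exact ⟨hΛ.apply_mem_separableCone hX.1, (hΛ.isCPTP.2 X).trans hX.2⟩

end Separable

section OpClass

variable {a b a' b' : ℕ} {Λ : SuperOp (Fin a × Fin b) (Fin a' × Fin b')}

theorem IsOneWayLOCC.mem_ops (hΛ : IsOneWayLOCC Λ) (O : OpClass) : Λ ∈ O.ops a b a' b' :=
  match O with
  | .oneWayLOCC => hΛ
  | .LOCC => hΛ.isLOCC
  | .PPT => hΛ.isLOCC.mem_ops_PPT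
  | .rainsPreserving => OpClass.ops_PPT_subset_rainsPreserving hΛ.isLOCC.mem_ops_PPT
  | .pptPreserving => OpClass.ops_PPT_subset_pptPreserving hΛ.isLOCC.mem_ops_PPT
  | .separabilityPreserving => hΛ.isLOCC.mem_ops_separabilityPreserving

theorem OpClass.isCPTP_of_mem_ops {O : OpClass} (hΛ : Λ ∈ O.ops a b a' b') : Λ.IsCPTP :=
  match O, hΛ with
  | .oneWayLOCC, hΛ => IsLOCC.isCPTP (IsOneWayLOCC.isLOCC hΛ)
  | .LOCC, hΛ => IsLOCC.isCPTP hΛ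
  | .PPT, hΛ | .rainsPreserving, hΛ | .pptPreserving, hΛ | .separabilityPreserving, hΛ => hΛ.1

/-- The only property of a class of operations, besides complete positivity, that limits
distillation. -/
theorem OpClass.apply_mem_rainsSet {O : OpClass} (hΛ : Λ ∈ O.ops a b a' b')
    {X : Matrix (Fin a × Fin b) (Fin a × Fin b) ℂ} (hX : X ∈ separableStates a b) :
    Λ X ∈ rainsSet a' b' :=
  have hX_ppt : X ∈ pptStates a b := separableStates_subset_pptStates hX
  have h_PPT (hΛ : Λ ∈ OpClass.PPT.ops a b a' b') : Λ X ∈ rainsSet a' b' :=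
    pptStates_subset_rainsSet ((OpClass.ops_PPT_subset_pptPreserving hΛ).2 X hX_ppt)
  match O, hΛ with
  | .oneWayLOCC, hΛ => h_PPT (IsOneWayLOCC.isLOCC hΛ).mem_ops_PPT
  | .LOCC, hΛ => h_PPT (IsLOCC.mem_ops_PPT hΛ)
  | .PPT, hΛ => h_PPT hΛ
  | .rainsPreserving, hΛ => hΛ.2 X (pptStates_subset_rainsSet hX_ppt)
  | .pptPreserving, hΛ => pptStates_subset_rainsSet (hΛ.2 X hX_ppt)
  | .separabilityPreserving, hΛ =>
    pptStates_subset_rainsSet (separableStates_subset_pptStates (hΛ.2 X hX))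

end OpClass

section RainsBound

theorem isStarProjection_rankOne {n : Type} [Fintype n] {x : EuclideanSpace ℂ n} (hx : ‖x‖ = 1) :
    IsStarProjection (rankOne x.ofLp) := by
  refine ⟨?_, (posSemidef_rankOne x.ofLp).1⟩
  rw [IsIdempotentElem, rankOne, Matrix.vecMulVec_mul_vecMulVec, dotProduct_comm,
    ← EuclideanSpace.inner_eq_star_dotProduct, inner_self_eq_norm_sq_to_K, hx]
  simp

theorem re_trace_mul_rankOne_le {n : Type} [Fintype n] {A : Matrix n n ℂ} (hA : A.PosSemidef)
    {x : EuclideanSpace ℂ n} (hx : ‖x‖ = 1) : (A * rankOne x.ofLp).trace.re ≤ A.trace.re := by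
  classical
  open scoped MatrixOrder in
  have h_le := trace_mul_nonneg hA
    (Matrix.nonneg_iff_posSemidef.1 (isStarProjection_rankOne hx).one_sub.nonneg)
  rw [Matrix.mul_sub, Matrix.mul_one, Matrix.trace_sub] at h_le
  exact sub_nonneg.1 (Complex.nonneg_iff.1 h_le).1

/-- The unit vector `|Ψ_m⟩`. -/
def maxEntangledVector (m : ℕ) : EuclideanSpace ℂ (Fin m × Fin m) :=
  WithLp.toLp 2 fun p => if p.1 = p.2 then ((1 / √m : ℝ) : ℂ) else 0

theorem norm_maxEntangledVector {m : ℕ} (hm : 0 < m) : ‖maxEntangledVector m‖ = 1 := by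
  rw [EuclideanSpace.norm_eq, maxEntangledVector, Fintype.sum_prod_type]
  simp [apply_ite norm, ite_pow, hm.ne']

/-- The operator on `ℂⁿ ⊗ ℂⁿ` that exchanges the two tensor factors. -/
def swapMatrix (n : Type) [DecidableEq n] : Matrix (n × n) (n × n) ℂ :=
  Equiv.Perm.permMatrix ℂ (Equiv.prodComm n n)

theorem swapMatrix_mul_self (n : Type) [Fintype n] [DecidableEq n] :
    swapMatrix n * swapMatrix n = 1 := by
  rw [swapMatrix, ← Matrix.permMatrix_mul]
  exact Matrix.permMatrix_one

theorem isHermitian_swapMatrix (n : Type) [DecidableEq n] : (swapMatrix n).IsHermitian :=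
  Matrix.conjTranspose_permMatrix _

theorem trace_partialTranspose_mul {a b : Type} [Fintype a] [Fintype b]
    (X Y : Matrix (a × b) (a × b) ℂ) :
    (partialTranspose a b X * Y).trace = (X * partialTranspose a b Y).trace := by
  simp only [Matrix.trace, Matrix.diag_apply, Matrix.mul_apply, Fintype.sum_prod_type]
  refine Finset.sum_congr rfl fun i _ => ?_
  rw [Finset.sum_comm, Finset.sum_comm (s := (Finset.univ : Finset b))]
  exact Finset.sum_congr rfl fun j _ => Finset.sum_comm

theorem maxEntangled_eq_smul_partialTranspose_swapMatrix (m : ℕ) :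
    maxEntangled m = (1 / m : ℝ) • partialTranspose (Fin m) (Fin m) (swapMatrix (Fin m)) := by
  ext ⟨i, j⟩ ⟨k, l⟩
  have h_sqrt : ((√m : ℝ) : ℂ)⁻¹ * ((√m : ℝ) : ℂ)⁻¹ = (m : ℂ)⁻¹ := by
    rw [← mul_inv, ← Complex.ofReal_mul, Real.mul_self_sqrt m.cast_nonneg, Complex.ofReal_natCast]
  have h_swap : partialTranspose (Fin m) (Fin m) (swapMatrix (Fin m)) (i, j) (k, l) =
      if i = j ∧ k = l then 1 else 0 := by
    change swapMatrix (Fin m) (i, l) (k, j) = _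
    simp [swapMatrix, Equiv.Perm.permMatrix, Equiv.toPEquiv_apply, and_comm, eq_comm]
  rw [Matrix.smul_apply, h_swap, maxEntangled, rankOne, Matrix.vecMulVec_apply, Pi.star_apply]
  by_cases hij : i = j <;> by_cases hkl : k = l <;> simp [hij, hkl, h_sqrt]

theorem re_trace_mul_maxEntangled_le {m : ℕ} {X : Matrix (Fin m × Fin m) (Fin m × Fin m) ℂ}
    (hX : X ∈ rainsSet m m) : (X * maxEntangled m).trace.re ≤ 1 / m := by
  have h_herm := isHermitian_swapMatrix (Fin m)
  have h_sq := swapMatrix_mul_self (Fin m)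
  rw [maxEntangled_eq_smul_partialTranspose_swapMatrix, Matrix.mul_smul, Matrix.trace_smul,
    ← trace_partialTranspose_mul, Complex.smul_re, smul_eq_mul]
  refine mul_le_of_le_one_right (by positivity) ((le_abs_self _).trans ?_)
  exact (abs_re_trace_mul_le_traceNorm (isHermitian_partialTranspose hX.1.1)
    (posSemidef_one_add_of_mul_self_eq_one h_herm h_sq)
    (posSemidef_one_sub_of_mul_self_eq_one h_herm h_sq)).trans hX.2

end RainsBound

section Contraction

/-- The nonnegative vectors `ω` with `‖ω‖₂ ≤ 1` and `‖ω‖_∞² ≤ t`. For `t = 1 / m` they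
parametrise the strategies for distilling `Ψ_m` from a pure state. -/
def flatVectors (ι : Type*) [Fintype ι] (t : ℝ) : Set (ι → ℝ) :=
  {ω | (∀ i, 0 ≤ ω i) ∧ ‖WithLp.toLp 2 ω‖ ≤ 1 ∧ ∀ i, ω i ^ 2 ≤ t}

theorem exists_mem_flatVectors_norm_map_sum_le {𝕜 E F ι : Type*} [RCLike 𝕜]
    [NormedAddCommGroup E] [InnerProductSpace 𝕜 E] [CompleteSpace E] [NormedAddCommGroup F]
    [InnerProductSpace 𝕜 F] [CompleteSpace F] [Fintype ι] {T : E →L[𝕜] F} (hT : ‖T‖ ≤ 1)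
    {u : ι → E} (hu : Orthonormal 𝕜 u) {ξ : ι → ℝ} (hξ : ∀ i, 0 ≤ ξ i) {t : ℝ}
    (hTu : ∀ i, ‖T (u i)‖ ^ 2 ≤ t) :
    ∃ ω ∈ flatVectors ι t, ‖T (∑ i, (ξ i : 𝕜) • u i)‖ ≤ ξ ⬝ᵥ ω := by
  set ψ := ∑ i, (ξ i : 𝕜) • u i with hψ
  set z : F := ((‖T ψ‖⁻¹ : ℝ) : 𝕜) • T ψ with hz_def
  have hz : ‖z‖ ≤ 1 := by
    rw [norm_smul, RCLike.norm_ofReal, abs_of_nonneg (by positivity)]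
    exact inv_mul_le_one
  have h_inner : (‖T ψ‖ : 𝕜) = ∑ i, (ξ i : 𝕜) * inner 𝕜 (T (u i)) z := by
    have h_sum : inner 𝕜 (T ψ) z = ∑ i, (ξ i : 𝕜) * inner 𝕜 (T (u i)) z := by
      simp only [hψ, map_sum, map_smul, sum_inner, inner_smul_left, RCLike.conj_ofReal]
    rw [← h_sum, hz_def, inner_smul_right, inner_self_eq_norm_sq_to_K]
    norm_cast
    rw [sq, ← mul_assoc]
    exact (inv_mul_mul_self _).symm
  refine ⟨fun i => ‖inner 𝕜 (T (u i)) z‖, ⟨fun i => norm_nonneg _, ?_, fun i => ?_⟩, ?_⟩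
  · have h_adjoint : ‖T.adjoint z‖ ≤ 1 := by
      refine (T.adjoint.le_opNorm z).trans (mul_le_one₀ ?_ (norm_nonneg z) hz)
      rwa [LinearIsometryEquiv.norm_map]
    rw [← sq_le_one_iff₀ (norm_nonneg _), EuclideanSpace.norm_sq_eq]
    simp_rw [norm_norm, ← T.adjoint_inner_right]
    exact (hu.sum_inner_products_le _).trans (pow_le_one₀ (norm_nonneg _) h_adjoint)
  · refine le_trans ?_ (hTu i)
    gcongr
    exact (norm_inner_le_norm _ _).trans (mul_le_of_le_one_right (norm_nonneg _) hz)
  · calc ‖T ψ‖ = ‖∑ i, (ξ i : 𝕜) * inner 𝕜 (T (u i)) z‖ := by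
          rw [← h_inner, RCLike.norm_ofReal, abs_norm]
      _ ≤ ∑ i, ‖(ξ i : 𝕜) * inner 𝕜 (T (u i)) z‖ := norm_sum_le _ _
      _ = ξ ⬝ᵥ fun i => ‖inner 𝕜 (T (u i)) z‖ := by
        simp only [norm_mul, RCLike.norm_ofReal, abs_of_nonneg (hξ _), dotProduct]

end Contraction

section UpperBound

theorem exists_apply_rankOne_eq_norm_sq {n : Type} [Fintype n] {f : Matrix n n ℂ →ₗ[ℂ] ℂ}
    (hf : ∀ x, 0 ≤ f (rankOne x)) :
    ∃ T : EuclideanSpace ℂ n →L[ℂ] EuclideanSpace ℂ n,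
      ∀ x : EuclideanSpace ℂ n, f (rankOne x.ofLp) = (‖T x‖ ^ 2 : ℝ) := by
  classical
  set W : Matrix n n ℂ := Matrix.of fun i j => f (Matrix.single j i 1) with hW
  have h_quadratic (x : n → ℂ) : f (rankOne x) = star x ⬝ᵥ (W *ᵥ x) := by
    rw [Matrix.matrix_eq_sum_single (rankOne x), Finset.sum_comm]
    simp only [map_sum, dotProduct, Matrix.mulVec, Finset.mul_sum]
    refine Finset.sum_congr rfl fun i _ => Finset.sum_congr rfl fun j _ => ?_
    rw [← mul_one (rankOne x j i), ← smul_eq_mul, ← Matrix.smul_single, map_smul, smul_eq_mul,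
      rankOne, Matrix.vecMulVec_apply, hW, Matrix.of_apply]
    ring
  have hW_posSemidef : W.PosSemidef :=
    posSemidef_of_dotProduct_mulVec_nonneg fun x => h_quadratic x ▸ hf x
  obtain ⟨B, hB⟩ := exists_eq_conjTranspose_mul_self_of_posSemidef hW_posSemidef
  refine ⟨(Matrix.toEuclideanLin B).toContinuousLinearMap, fun x => ?_⟩
  rw [h_quadratic, hB, ← Matrix.mulVec_mulVec, Matrix.dotProduct_mulVec, ← Matrix.star_mulVec,
    dotProduct_comm]
  have h_inner := inner_self_eq_norm_sq_to_K (𝕜 := ℂ) (Matrix.toEuclideanLin B x)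
  rw [EuclideanSpace.inner_eq_star_dotProduct] at h_inner
  exact_mod_cast h_inner

/-- The product vector `x ⊗ y`. -/
def productVector {a b : Type} (x : EuclideanSpace ℂ a) (y : EuclideanSpace ℂ b) :
    EuclideanSpace ℂ (a × b) :=
  WithLp.toLp 2 fun p => x p.1 * y p.2

theorem orthonormal_productVector {a b : Type} {ι : Type*} [Fintype a] [Fintype b]
    {e : ι → EuclideanSpace ℂ a} {f : ι → EuclideanSpace ℂ b} (he : Orthonormal ℂ e)
    (hf : Orthonormal ℂ f) : Orthonormal ℂ fun i => productVector (e i) (f i) := by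
  classical
  rw [orthonormal_iff_ite] at he hf ⊢
  intro i j
  have h_inner : inner ℂ (productVector (e i) (f i)) (productVector (e j) (f j)) =
      inner ℂ (e i) (e j) * inner ℂ (f i) (f j) := by
    simp only [productVector, PiLp.inner_apply, Fintype.sum_prod_type, Finset.sum_mul_sum,
      RCLike.inner_apply, map_mul]
    exact Finset.sum_congr rfl fun k _ => Finset.sum_congr rfl fun l _ => mul_mul_mul_comm _ _ _ _
  rw [h_inner, he, hf]
  split_ifs <;> simp

variable {a b m : ℕ} {ψ : EuclideanSpace ℂ (Fin a × Fin b)} {ξ : Fin (min a b) → ℝ}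

theorem IsSchmidtVector.exists_eq_sum_productVector (hξ : IsSchmidtVector ψ ξ) :
    ∃ (e : Fin (min a b) → EuclideanSpace ℂ (Fin a))
      (f : Fin (min a b) → EuclideanSpace ℂ (Fin b)), Orthonormal ℂ e ∧ Orthonormal ℂ f ∧
      ψ = ∑ i, (ξ i : ℂ) • productVector (e i) (f i) := by
  obtain ⟨-, e, f, he, hf, hψ⟩ := hξ
  refine ⟨e, f, he, hf, ?_⟩
  ext p
  simp [hψ, productVector]

/-- The functional `X ↦ Tr(Λ(X) Ψ_m)` is positive, hence of the form `|x⟩⟨x| ↦ ‖T x‖²`; the Rains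
bound controls `T` on product vectors. -/
theorem exists_mem_flatVectors_re_trace_le {O : OpClass} (hm : 0 < m) (hξ : IsSchmidtVector ψ ξ)
    {Λ : SuperOp (Fin a × Fin b) (Fin m × Fin m)} (hΛ : Λ ∈ O.ops a b m m) :
    ∃ ω ∈ flatVectors (Fin (min a b)) (1 / m),
      ((Λ (rankOne ψ.ofLp))ᴴ * maxEntangled m).trace.re ≤ (ξ ⬝ᵥ ω) ^ 2 := by
  have h_cptp : Λ.IsCPTP := OpClass.isCPTP_of_mem_ops hΛ
  have h_pos (x : Fin a × Fin b → ℂ) : (Λ (rankOne x)).PosSemidef :=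
    h_cptp.1.posSemidef (posSemidef_rankOne x)
  obtain ⟨T, hT⟩ := exists_apply_rankOne_eq_norm_sq
    (f := Matrix.traceLinearMap _ ℂ ℂ ∘ₗ LinearMap.mulRight ℂ (maxEntangled m) ∘ₗ Λ)
    fun x => trace_mul_nonneg (h_pos x) (posSemidef_rankOne _)
  replace hT (x : EuclideanSpace ℂ (Fin a × Fin b)) :
      ‖T x‖ ^ 2 = (Λ (rankOne x.ofLp) * maxEntangled m).trace.re :=
    (congrArg Complex.re (hT x)).symm
  have hT_contraction : ‖T‖ ≤ 1 := by
    refine T.opNorm_le_bound zero_le_one fun x => ?_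
    rw [one_mul, ← sq_le_sq₀ (norm_nonneg _) (norm_nonneg _), hT]
    refine (re_trace_mul_rankOne_le (h_pos x.ofLp) (norm_maxEntangledVector hm)).trans_eq ?_
    rw [h_cptp.2, trace_rankOne, Complex.ofReal_re]
  obtain ⟨e, f, he, hf, hψ⟩ := hξ.exists_eq_sum_productVector
  have hT_product (i : Fin (min a b)) : ‖T (productVector (e i) (f i))‖ ^ 2 ≤ 1 / m := by
    rw [hT]
    exact re_trace_mul_maxEntangled_le <| OpClass.apply_mem_rainsSet hΛ <|
      subset_convexHull ℝ _ ⟨e i, f i, he.1 i, hf.1 i, rfl⟩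
  obtain ⟨ω, hω, h_le⟩ := exists_mem_flatVectors_norm_map_sum_le hT_contraction
    (orthonormal_productVector he hf) hξ.1 hT_product
  refine ⟨ω, hω, ?_⟩
  rw [(h_pos ψ.ofLp).1.eq, ← hT, hψ]
  gcongr
  exact h_le

end UpperBound

section RandomAssignment

variable {ι κ : Type*}

/-- A permutation `σ` of `ι ⊕ κ` encodes a partial injection from `ι` to `κ`, defined at the `i : ι`
that `σ` maps into `κ`. This is the indicator of its domain. -/
def slotIndicator (σ : Equiv.Perm (ι ⊕ κ)) (i : ι) : ℝ :=
  Sum.elim 0 1 (σ (Sum.inl i))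

theorem slotIndicator_le_one (σ : Equiv.Perm (ι ⊕ κ)) (i : ι) : slotIndicator σ i ≤ 1 := by
  rw [slotIndicator]
  rcases σ (Sum.inl i) with _ | _
  exacts [zero_le_one, le_rfl]

variable [DecidableEq κ]

/-- The basis vector `|k⟩` if `σ` maps `i : ι` to `k : κ`, and `0` if `σ` maps `i` into `ι`. -/
def slotVector (σ : Equiv.Perm (ι ⊕ κ)) (i : ι) : κ → ℂ :=
  Sum.elim 0 (fun k => Pi.single k 1) (σ (Sum.inl i))

theorem star_slotVector (σ : Equiv.Perm (ι ⊕ κ)) (i : ι) :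
    star (slotVector σ i) = slotVector σ i := by
  rw [slotVector]
  rcases σ (Sum.inl i) with _ | k
  · exact star_zero _
  · rw [Sum.elim_inr, Pi.star_single, star_one]

theorem slotVector_dotProduct_slotVector [DecidableEq ι] [Fintype κ] (σ : Equiv.Perm (ι ⊕ κ))
    (i j : ι) :
    slotVector σ i ⬝ᵥ slotVector σ j = if i = j then (slotIndicator σ i : ℂ) else 0 := by
  have h_inj : i = j ↔ σ (Sum.inl i) = σ (Sum.inl j) := by
    rw [σ.injective.eq_iff, Sum.inl_injective.eq_iff]
  rw [slotVector, slotVector, slotIndicator, if_congr h_inj rfl rfl]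
  rcases σ (Sum.inl i) with i' | k <;> rcases σ (Sum.inl j) with j' | l <;>
    simp [Pi.single_apply, eq_comm]

theorem sum_permMatrix_inl_inr [DecidableEq ι] [Fintype κ] (σ : Equiv.Perm (ι ⊕ κ)) (i : ι) :
    ∑ k, (σ.permMatrix ℝ).toBlocks₁₂ i k = slotIndicator σ i := by
  rw [slotIndicator]
  rcases h : σ (Sum.inl i) with j | k <;> simp [Matrix.toBlocks₁₂, h]

variable [Fintype ι] [Fintype κ] [DecidableEq ι]

/-- The dilation of `A` by its row and column defects is doubly stochastic, so that Birkhoff's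
theorem applies. -/
theorem exists_eq_sum_permMatrix_toBlocks₁₂ {A : Matrix ι κ ℝ} (hA : ∀ i k, 0 ≤ A i k)
    (h_row : ∀ i, ∑ k, A i k ≤ 1) (h_col : ∀ k, ∑ i, A i k ≤ 1) :
    ∃ w : Equiv.Perm (ι ⊕ κ) → ℝ, (∀ σ, 0 ≤ w σ) ∧ ∑ σ, w σ = 1 ∧
      ∑ σ, w σ • (σ.permMatrix ℝ).toBlocks₁₂ = A := by
  have h_stochastic : Matrix.fromBlocks (Matrix.diagonal fun i => 1 - ∑ k, A i k) A Aᵀ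
      (Matrix.diagonal fun k => 1 - ∑ i, A i k) ∈ doublyStochastic ℝ (ι ⊕ κ) := by
    rw [mem_doublyStochastic_iff_sum]
    refine ⟨?_, ?_, ?_⟩
    · rintro (i | k) (j | l)
      · rw [Matrix.fromBlocks_apply₁₁, Matrix.diagonal_apply]
        split_ifs
        exacts [sub_nonneg.2 (h_row i), le_rfl]
      · exact hA i l
      · exact hA j k
      · rw [Matrix.fromBlocks_apply₂₂, Matrix.diagonal_apply]
        split_ifs
        exacts [sub_nonneg.2 (h_col k), le_rfl]
    all_goals
      rintro (i | k) <;>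
      simp [Fintype.sum_sum_type, Matrix.diagonal_apply]
  obtain ⟨w, hw_nonneg, hw_sum, hw⟩ := exists_eq_sum_perm_of_mem_doublyStochastic h_stochastic
  refine ⟨w, hw_nonneg, hw_sum, ?_⟩
  ext i k
  simpa [Matrix.sum_apply, Matrix.toBlocks₁₂] using congrFun (congrFun hw (Sum.inl i)) (Sum.inr k)

theorem exists_weights_of_mem_flatVectors {m : ℕ} (hm : 0 < m) {ω : ι → ℝ}
    (hω : ω ∈ flatVectors ι (1 / m)) :
    ∃ w : Equiv.Perm (ι ⊕ Fin m) → ℝ, (∀ σ, 0 ≤ w σ) ∧ ∑ σ, w σ = 1 ∧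
      ∀ i, ∑ σ, w σ * slotIndicator σ i = m * ω i ^ 2 := by
  have hm' : (0 : ℝ) < m := Nat.cast_pos.2 hm
  have h_norm : ∑ i, ω i ^ 2 ≤ 1 := by
    have h_sq := pow_le_one₀ (n := 2) (norm_nonneg _) hω.2.1
    simpa only [EuclideanSpace.norm_sq_eq, Real.norm_eq_abs, sq_abs] using h_sq
  obtain ⟨w, hw_nonneg, hw_sum, hw⟩ :=
    exists_eq_sum_permMatrix_toBlocks₁₂ (A := fun (i : ι) (_ : Fin m) => ω i ^ 2)
      (fun i _ => sq_nonneg (ω i))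
      (fun i => by simpa [← le_div_iff₀' hm'] using hω.2.2 i) (fun _ => h_norm)
  refine ⟨w, hw_nonneg, hw_sum, fun i => ?_⟩
  calc ∑ σ, w σ * slotIndicator σ i
      = ∑ k, (∑ σ, w σ • (σ.permMatrix ℝ).toBlocks₁₂) i k := by
        simp only [← sum_permMatrix_inl_inr, Finset.mul_sum, Matrix.sum_apply, Matrix.smul_apply,
          smul_eq_mul]
        exact Finset.sum_comm
    _ = m * ω i ^ 2 := by simp [hw]

end RandomAssignment

section Transfer

variable {ι : Type*} {n k : Type} [Fintype ι]

/-- The operator `∑ i, |v i⟩⟨e i|`. -/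
def transferMatrix (e : ι → EuclideanSpace ℂ n) (v : ι → k → ℂ) : Matrix k n ℂ :=
  ∑ i, Matrix.vecMulVec (v i) (star (e i).ofLp)

variable {e : ι → EuclideanSpace ℂ n} {v : ι → k → ℂ}

theorem transferMatrix_mulVec [Fintype n] (he : Orthonormal ℂ e) (i : ι) :
    transferMatrix e v *ᵥ (e i).ofLp = v i := by
  classical
  have h_inner (j : ι) : star (e j).ofLp ⬝ᵥ (e i).ofLp = if j = i then 1 else 0 := by
    rw [dotProduct_comm, ← EuclideanSpace.inner_eq_star_dotProduct, orthonormal_iff_ite.1 he]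
  simp [transferMatrix, Matrix.sum_mulVec, Matrix.vecMulVec_mulVec, h_inner]

theorem conjTranspose_transferMatrix_mul_self [Fintype k]
    (hv : Pairwise fun i j => star (v i) ⬝ᵥ v j = 0) :
    (transferMatrix e v)ᴴ * transferMatrix e v =
      ∑ i, (star (v i) ⬝ᵥ v i) • rankOne (e i).ofLp := by
  simp only [transferMatrix, Matrix.conjTranspose_sum, Matrix.sum_mul, Matrix.mul_sum,
    Matrix.conjTranspose_vecMulVec, star_star, Matrix.vecMulVec_mul_vecMulVec]
  refine Finset.sum_congr rfl fun i _ => ?_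
  rw [Finset.sum_eq_single i (fun j _ hj => by rw [hv hj, zero_smul, Matrix.vecMulVec_zero])
    (absurd (Finset.mem_univ i)), Matrix.vecMulVec_smul, rankOne]

theorem star_dotProduct_rankOne_mulVec [Fintype n] (x y : EuclideanSpace ℂ n) :
    star y.ofLp ⬝ᵥ (rankOne x.ofLp *ᵥ y.ofLp) = (‖inner ℂ x y‖ ^ 2 : ℝ) := by
  rw [rankOne, Matrix.vecMulVec_mulVec, dotProduct_smul, MulOpposite.smul_eq_mul_unop,
    MulOpposite.unop_op, dotProduct_comm, dotProduct_comm (star _) y.ofLp,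
    ← EuclideanSpace.inner_eq_star_dotProduct, ← EuclideanSpace.inner_eq_star_dotProduct,
    ← inner_conj_symm, RCLike.conj_mul]
  norm_cast

/-- Bessel's inequality in operator form. -/
theorem posSemidef_one_sub_sum_smul_rankOne [Fintype n] [DecidableEq n] (he : Orthonormal ℂ e)
    {t : ι → ℝ} (ht : ∀ i, t i ≤ 1) :
    (1 - ∑ i, (t i : ℂ) • rankOne (e i).ofLp).PosSemidef := by
  refine posSemidef_of_dotProduct_mulVec_nonneg fun x => ?_
  have h_quadratic : star x ⬝ᵥ ((1 - ∑ i, (t i : ℂ) • rankOne (e i).ofLp) *ᵥ x) =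
      (‖WithLp.toLp 2 x‖ ^ 2 - ∑ i, t i * ‖inner ℂ (e i) (WithLp.toLp 2 x)‖ ^ 2 : ℝ) := by
    have h_norm : star x ⬝ᵥ x = (‖WithLp.toLp 2 x‖ ^ 2 : ℝ) := by
      rw [← trace_rankOne, rankOne, Matrix.trace_vecMulVec, dotProduct_comm]
    simp only [Matrix.sub_mulVec, Matrix.one_mulVec, Matrix.sum_mulVec, Matrix.smul_mulVec,
      dotProduct_sub, dotProduct_sum, dotProduct_smul, h_norm,
      star_dotProduct_rankOne_mulVec _ (WithLp.toLp 2 x), smul_eq_mul]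
    push_cast
    rfl
  rw [h_quadratic, Complex.zero_le_real, sub_nonneg]
  calc ∑ i, t i * ‖inner ℂ (e i) (WithLp.toLp 2 x)‖ ^ 2
      ≤ ∑ i, ‖inner ℂ (e i) (WithLp.toLp 2 x)‖ ^ 2 :=
        Finset.sum_le_sum fun i _ => mul_le_of_le_one_left (sq_nonneg _) (ht i)
    _ ≤ ‖WithLp.toLp 2 x‖ ^ 2 := he.sum_inner_products_le _

end Transfer

section KrausCompletion

open scoped Kronecker

namespace SuperOp

variable {n k : Type} [Fintype n]

theorem trace_conj [Fintype k] (K : Matrix k n ℂ) (X : Matrix n n ℂ) :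
    (conj K X).trace = (Kᴴ * K * X).trace := by
  rw [conj_apply, Matrix.trace_mul_comm, Matrix.mul_assoc]

theorem exists_isCP_trace_eq [Fintype k] [Nonempty k] {G : Matrix n n ℂ} (hG : G.PosSemidef) :
    ∃ R : SuperOp n k, R.IsCP ∧ ∀ X, (R X).trace = (G * X).trace := by
  classical
  obtain ⟨B, rfl⟩ := exists_eq_conjTranspose_mul_self_of_posSemidef hG
  let K (i : n) : Matrix k n ℂ := Matrix.vecMulVec (Pi.single (Classical.arbitrary k) 1) (B i)
  have hK : ∑ i, (K i)ᴴ * K i = Bᴴ * B := by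
    ext j l
    simp [K, Matrix.sum_apply, Matrix.mul_apply, Matrix.conjTranspose_vecMulVec,
      Matrix.vecMulVec_mul_vecMulVec, Matrix.vecMulVec_apply]
  refine ⟨∑ i, conj (K i), IsCP.sum fun i _ => isCP_conj (K i), fun X => ?_⟩
  simp only [LinearMap.sum_apply, Matrix.trace_sum, trace_conj, ← hK, Matrix.sum_mul]

theorem exists_isCPTP_conj_add [DecidableEq n] [Fintype k] [Nonempty k] {V : Matrix k n ℂ}
    (hV : (1 - Vᴴ * V).PosSemidef) :
    ∃ S : SuperOp n k, S.IsCP ∧ IsCPTP (conj V + S) := by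
  obtain ⟨S, hS, hS_trace⟩ := exists_isCP_trace_eq (k := k) hV
  refine ⟨S, hS, (isCP_conj V).add hS, fun X => ?_⟩
  rw [LinearMap.add_apply, Matrix.trace_add, trace_conj, hS_trace, ← Matrix.trace_add,
    ← Matrix.add_mul, add_sub_cancel, Matrix.one_mul]

end SuperOp

theorem isOneWayLOCC_sum_tensor {ι : Type*} [Fintype ι] {a b a' b' : ℕ}
    {E : ι → SuperOp (Fin a) (Fin a')} {D : ι → SuperOp (Fin b) (Fin b')}
    (hE : ∀ i, (E i).IsCP) (hE_trace : ∀ X, ∑ i, (E i X).trace = X.trace)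
    (hD : ∀ i, (D i).IsCPTP) : IsOneWayLOCC (∑ i, (E i).tensor (D i)) := by
  let q := (Fintype.equivFin ι).symm
  refine ⟨_, E ∘ q, D ∘ q, ⟨fun j => hE (q j), fun X => ?_⟩, fun j => hD (q j),
    (q.sum_comp fun i => (E i).tensor (D i)).symm⟩
  rw [← hE_trace X]
  exact q.sum_comp fun i => (E i X).trace

/-- The defect of `K` becomes an additional outcome of Alice, the defect of `V i` is added to the
channel of Bob. -/
theorem exists_isOneWayLOCC_of_kraus {ι : Type*} [Fintype ι] {a b a' b' : ℕ} [NeZero a']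
    [NeZero b'] {K : ι → Matrix (Fin a') (Fin a) ℂ} {V : ι → Matrix (Fin b') (Fin b) ℂ}
    (hK : (1 - ∑ i, (K i)ᴴ * K i).PosSemidef) (hV : ∀ i, (1 - (V i)ᴴ * V i).PosSemidef) :
    ∃ Λ : SuperOp (Fin a × Fin b) (Fin a' × Fin b'), IsOneWayLOCC Λ ∧
      ∀ ρ, ρ.PosSemidef → (Λ ρ - ∑ i, SuperOp.conj (K i ⊗ₖ V i) ρ).PosSemidef := by
  obtain ⟨R, hR, hR_trace⟩ := SuperOp.exists_isCP_trace_eq (k := Fin a') hK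
  choose S hS hVS using fun i => SuperOp.exists_isCPTP_conj_add (hV i)
  obtain ⟨D, -, hD⟩ := SuperOp.exists_isCPTP_conj_add (V := (0 : Matrix (Fin b') (Fin b) ℂ))
    (by simpa using Matrix.PosSemidef.one)
  let E : Option ι → SuperOp (Fin a) (Fin a') := fun o => o.elim R fun i => SuperOp.conj (K i)
  let F : Option ι → SuperOp (Fin b) (Fin b') :=
    fun o => o.elim (SuperOp.conj 0 + D) fun i => SuperOp.conj (V i) + S i
  have hE (o) : (E o).IsCP := o.rec hR fun i => SuperOp.isCP_conj (K i)
  have hF (o) : (F o).IsCPTP := o.rec hD hVS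
  refine ⟨_, isOneWayLOCC_sum_tensor hE (fun X => ?_) hF, fun ρ hρ => ?_⟩
  · simp only [E, Fintype.sum_option, Option.elim, hR_trace, SuperOp.trace_conj]
    rw [← Matrix.trace_sum, ← Matrix.sum_mul, ← Matrix.trace_add, ← Matrix.add_mul,
      sub_add_cancel, Matrix.one_mul]
  · have h_split : (∑ o, (E o).tensor (F o)) ρ - ∑ i, SuperOp.conj (K i ⊗ₖ V i) ρ =
        (E none).tensor (F none) ρ + ∑ i, (SuperOp.conj (K i)).tensor (S i) ρ := by
      rw [Fintype.sum_option, LinearMap.add_apply, LinearMap.sum_apply, add_sub_assoc,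
        ← Finset.sum_sub_distrib]
      simp only [E, F, Option.elim, SuperOp.tensor_add_right, LinearMap.add_apply,
        SuperOp.conj_tensor_conj, add_sub_cancel_left]
    rw [h_split]
    exact (((hE none).tensor (hF none).1).posSemidef hρ).add <|
      Matrix.posSemidef_sum _ fun i _ => ((SuperOp.isCP_conj (K i)).tensor (hS i)).posSemidef hρ

end KrausCompletion

section LowerBound

open scoped Kronecker

theorem kronecker_mulVec_productVector {a a' b b' : Type} [Fintype a] [Fintype b]
    (K : Matrix a' a ℂ) (V : Matrix b' b ℂ) (x : EuclideanSpace ℂ a) (y : EuclideanSpace ℂ b) :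
    (K ⊗ₖ V) *ᵥ (productVector x y).ofLp = fun p => (K *ᵥ x.ofLp) p.1 * (V *ᵥ y.ofLp) p.2 := by
  ext p
  simp only [productVector, Matrix.mulVec, dotProduct, Matrix.kroneckerMap_apply,
    Fintype.sum_prod_type, Finset.sum_mul_sum]
  exact Finset.sum_congr rfl fun i _ => Finset.sum_congr rfl fun j _ => mul_mul_mul_comm _ _ _ _

theorem trace_rankOne_mul_maxEntangled {m : ℕ} (x : Fin m × Fin m → ℂ) :
    (rankOne x * maxEntangled m).trace = (1 / m * ‖∑ k, x (k, k)‖ ^ 2 : ℝ) := by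
  have h_inner : inner ℂ (maxEntangledVector m) (WithLp.toLp 2 x) =
      (1 / √m : ℝ) * ∑ k, x (k, k) := by
    simp [maxEntangledVector, PiLp.inner_apply, Fintype.sum_prod_type, Finset.mul_sum,
      apply_ite (starRingEnd ℂ), mul_comm]
  change (rankOne x * rankOne (maxEntangledVector m).ofLp).trace = _
  rw [Matrix.trace_mul_comm, trace_mul_rankOne,
    star_dotProduct_rankOne_mulVec _ (WithLp.toLp 2 x), h_inner, norm_mul, mul_pow,
    Complex.norm_real, Real.norm_eq_abs, sq_abs, div_pow, one_pow, Real.sq_sqrt m.cast_nonneg]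

theorem trace_conj_transferMatrix_mul_maxEntangled {a b : Type} [Fintype a] [Fintype b] {m : ℕ}
    {ι : Type*} [Fintype ι] {e : ι → EuclideanSpace ℂ a} {f : ι → EuclideanSpace ℂ b}
    (he : Orthonormal ℂ e) (hf : Orthonormal ℂ f) (ξ : ι → ℂ) (u v : ι → Fin m → ℂ) :
    (SuperOp.conj (transferMatrix e u ⊗ₖ transferMatrix f v)
      (rankOne (∑ i, ξ i • productVector (e i) (f i)).ofLp) * maxEntangled m).trace =
      (1 / m * ‖∑ i, ξ i * (u i ⬝ᵥ v i)‖ ^ 2 : ℝ) := by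
  rw [SuperOp.conj_apply, mul_rankOne_mul_conjTranspose, trace_rankOne_mul_maxEntangled]
  have h_image : (transferMatrix e u ⊗ₖ transferMatrix f v) *ᵥ
      (∑ i, ξ i • productVector (e i) (f i)).ofLp = ∑ i, ξ i • fun p => u i p.1 * v i p.2 := by
    simp only [WithLp.ofLp_sum, WithLp.ofLp_smul, Matrix.mulVec_sum, Matrix.mulVec_smul,
      kronecker_mulVec_productVector, transferMatrix_mulVec he, transferMatrix_mulVec hf]
  rw [h_image]
  congr 4
  simp only [Finset.sum_apply, Pi.smul_apply, smul_eq_mul, dotProduct, Finset.mul_sum]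
  exact Finset.sum_comm

theorem sq_dotProduct_le_sum_weights {ι S : Type*} [Fintype ι] [Fintype S] {m : ℝ} (hm : 0 < m)
    {w : S → ℝ} (hw : ∀ σ, 0 ≤ w σ) (hw_sum : ∑ σ, w σ = 1) {p : S → ι → ℝ} {ω : ι → ℝ}
    (hp : ∀ i, ∑ σ, w σ * p σ i = m * ω i ^ 2) (ξ : ι → ℝ) :
    (ξ ⬝ᵥ ω) ^ 2 ≤ ∑ σ, 1 / m * (∑ i, ξ i * (√(w σ / m) / ω i * p σ i)) ^ 2 := by
  have h_mean : ξ ⬝ᵥ ω = ∑ σ, w σ * ∑ i, ξ i * (p σ i / (m * ω i)) := by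
    simp only [dotProduct, Finset.mul_sum]
    rw [Finset.sum_comm]
    refine Finset.sum_congr rfl fun i _ => ?_
    calc ξ i * ω i = ξ i * ((∑ σ, w σ * p σ i) / (m * ω i)) := by
          rw [hp, mul_div_mul_left _ _ hm.ne', sq, mul_self_div_self]
      _ = ∑ σ, w σ * (ξ i * (p σ i / (m * ω i))) := by
          rw [Finset.sum_div, Finset.mul_sum]
          exact Finset.sum_congr rfl fun σ _ => by ring
  have h_term (σ : S) : 1 / m * (∑ i, ξ i * (√(w σ / m) / ω i * p σ i)) ^ 2 =
      w σ * (∑ i, ξ i * (p σ i / (m * ω i))) ^ 2 := by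
    have h_factor : ∑ i, ξ i * (√(w σ / m) / ω i * p σ i) =
        √(w σ / m) * m * ∑ i, ξ i * (p σ i / (m * ω i)) := by
      rw [Finset.mul_sum]
      refine Finset.sum_congr rfl fun i _ => ?_
      field_simp
    rw [h_factor, mul_pow, mul_pow, Real.sq_sqrt (div_nonneg (hw σ) hm.le)]
    field_simp
  simp only [h_mean, h_term]
  exact Real.pow_arith_mean_le_arith_mean_pow_of_even _ _ _ (fun σ _ => hw σ) hw_sum even_two

section SlotMatrix

variable {ι : Type*} {κ n : Type} [Fintype ι] [DecidableEq κ]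

/-- The Kraus operator `∑ i, c i |σ i⟩⟨e i|`, the sum being over the `i : ι` that `σ` maps
into `κ`. -/
def slotMatrix (e : ι → EuclideanSpace ℂ n) (σ : Equiv.Perm (ι ⊕ κ)) (c : ι → ℝ) : Matrix κ n ℂ :=
  transferMatrix e fun i => (c i : ℂ) • slotVector σ i

theorem conjTranspose_slotMatrix_mul_self [Fintype κ] (e : ι → EuclideanSpace ℂ n)
    (σ : Equiv.Perm (ι ⊕ κ)) (c : ι → ℝ) :
    (slotMatrix e σ c)ᴴ * slotMatrix e σ c =
      ∑ i, ((c i ^ 2 * slotIndicator σ i : ℝ) : ℂ) • rankOne (e i).ofLp := by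
  classical
  have h_inner (i j : ι) : star ((c i : ℂ) • slotVector σ i) ⬝ᵥ ((c j : ℂ) • slotVector σ j) =
      if i = j then ((c i ^ 2 * slotIndicator σ i : ℝ) : ℂ) else 0 := by
    rw [star_smul, star_slotVector, smul_dotProduct, dotProduct_smul,
      slotVector_dotProduct_slotVector]
    split_ifs with hij <;> simp [hij, sq, mul_assoc]
  rw [slotMatrix, conjTranspose_transferMatrix_mul_self fun i j hij =>
    (h_inner i j).trans (if_neg hij)]
  simp only [h_inner, if_true]

theorem posSemidef_one_sub_sum_slotMatrix [Fintype κ] [Fintype n] [DecidableEq n] {S : Type*}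
    [Fintype S] {e : ι → EuclideanSpace ℂ n} (he : Orthonormal ℂ e) {σ : S → Equiv.Perm (ι ⊕ κ)}
    {c : S → ι → ℝ} (hc : ∀ i, ∑ s, c s i ^ 2 * slotIndicator (σ s) i ≤ 1) :
    (1 - ∑ s, (slotMatrix e (σ s) (c s))ᴴ * slotMatrix e (σ s) (c s)).PosSemidef := by
  have h_sum : ∑ s, (slotMatrix e (σ s) (c s))ᴴ * slotMatrix e (σ s) (c s) =
      ∑ i, ((∑ s, c s i ^ 2 * slotIndicator (σ s) i : ℝ) : ℂ) • rankOne (e i).ofLp := by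
    simp only [conjTranspose_slotMatrix_mul_self, Complex.ofReal_sum, Finset.sum_smul]
    exact Finset.sum_comm
  rw [h_sum]
  exact posSemidef_one_sub_sum_smul_rankOne he hc

end SlotMatrix

theorem re_trace_conj_slotMatrix_mul_maxEntangled {a b : Type} [Fintype a] [Fintype b] {m : ℕ}
    {ι : Type*} [Fintype ι] {e : ι → EuclideanSpace ℂ a} {f : ι → EuclideanSpace ℂ b}
    (he : Orthonormal ℂ e) (hf : Orthonormal ℂ f) (ξ : ι → ℝ) (σ : Equiv.Perm (ι ⊕ Fin m))
    (c : ι → ℝ) :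
    (SuperOp.conj (slotMatrix e σ c ⊗ₖ slotMatrix f σ 1)
      (rankOne (∑ i, (ξ i : ℂ) • productVector (e i) (f i)).ofLp) * maxEntangled m).trace.re =
      1 / m * (∑ i, ξ i * (c i * slotIndicator σ i)) ^ 2 := by
  classical
  rw [slotMatrix, slotMatrix, trace_conj_transferMatrix_mul_maxEntangled he hf, Complex.ofReal_re]
  have h_sum : ∑ i, (ξ i : ℂ) * (((c i : ℂ) • slotVector σ i) ⬝ᵥ
      ((((1 : ι → ℝ) i : ℝ) : ℂ) • slotVector σ i)) =
      ((∑ i, ξ i * (c i * slotIndicator σ i) : ℝ) : ℂ) := by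
    simp [smul_dotProduct, slotVector_dotProduct_slotVector]
  rw [h_sum, Complex.norm_real, Real.norm_eq_abs, sq_abs]

variable {a b m : ℕ} {ψ : EuclideanSpace ℂ (Fin a × Fin b)} {ξ ω : Fin (min a b) → ℝ}

/-- The amplitudes of Alice's Kraus operators are proportional to `1 / ω i`, where `1 / 0 = 0`
discards the Schmidt vectors with `ω i = 0`. -/
theorem exists_isOneWayLOCC_sq_dotProduct_le (hm : 0 < m) (hξ : IsSchmidtVector ψ ξ)
    (hω : ω ∈ flatVectors (Fin (min a b)) (1 / m)) :
    ∃ Λ : SuperOp (Fin a × Fin b) (Fin m × Fin m), IsOneWayLOCC Λ ∧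
      (ξ ⬝ᵥ ω) ^ 2 ≤ ((Λ (rankOne ψ.ofLp))ᴴ * maxEntangled m).trace.re := by
  have : NeZero m := ⟨hm.ne'⟩
  have hm' : (0 : ℝ) < m := Nat.cast_pos.2 hm
  obtain ⟨e, f, he, hf, hψ⟩ := hξ.exists_eq_sum_productVector
  obtain ⟨w, hw, hw_sum, hw_mean⟩ := exists_weights_of_mem_flatVectors hm hω
  have h_alice (i : Fin (min a b)) :
      ∑ σ, (√(w σ / m) / ω i) ^ 2 * slotIndicator σ i ≤ 1 := by
    calc ∑ σ, (√(w σ / m) / ω i) ^ 2 * slotIndicator σ i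
        = (∑ σ, w σ * slotIndicator σ i) / (m * ω i ^ 2) := by
          rw [Finset.sum_div]
          refine Finset.sum_congr rfl fun σ _ => ?_
          rw [div_pow, Real.sq_sqrt (div_nonneg (hw σ) hm'.le)]
          ring
      _ ≤ 1 := hw_mean i ▸ div_self_le_one _
  obtain ⟨Λ, hΛ, h_dominates⟩ := exists_isOneWayLOCC_of_kraus
    (K := fun σ : Equiv.Perm (Fin (min a b) ⊕ Fin m) =>
      slotMatrix e σ fun i => √(w σ / m) / ω i)
    (V := fun σ => slotMatrix f σ 1) (posSemidef_one_sub_sum_slotMatrix he h_alice) fun σ => by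
      rw [conjTranspose_slotMatrix_mul_self]
      exact posSemidef_one_sub_sum_smul_rankOne hf fun i => by
        simpa using slotIndicator_le_one σ i
  refine ⟨Λ, hΛ, ?_⟩
  have hρ := posSemidef_rankOne ψ.ofLp
  rw [(hΛ.isLOCC.isCPTP.1.posSemidef hρ).1.eq]
  refine (sq_dotProduct_le_sum_weights hm' hw hw_sum hw_mean ξ).trans ?_
  have h_gap : 0 ≤ ((Λ (rankOne ψ.ofLp) - ∑ σ, SuperOp.conj (slotMatrix e σ (fun i =>
      √(w σ / m) / ω i) ⊗ₖ slotMatrix f σ 1) (rankOne ψ.ofLp)) * maxEntangled m).trace.re :=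
    (Complex.nonneg_iff.1 (trace_mul_nonneg (h_dominates _ hρ) (posSemidef_rankOne _))).1
  rw [Matrix.sub_mul, Matrix.trace_sub, Matrix.sum_mul, Matrix.trace_sum, Complex.sub_re,
    Complex.re_sum, sub_nonneg] at h_gap
  refine le_trans (Finset.sum_le_sum fun σ _ => ?_) h_gap
  rw [hψ, re_trace_conj_slotMatrix_mul_maxEntangled he hf]

end LowerBound

section SchmidtDecomposition

theorem exists_orthonormal_eq_norm_smul {𝕜 E ι : Type*} [RCLike 𝕜] [NormedAddCommGroup E]
    [InnerProductSpace 𝕜 E] [FiniteDimensional 𝕜 E] [Fintype ι]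
    (h_card : Fintype.card ι ≤ Module.finrank 𝕜 E) {g : ι → E}
    (hg : Pairwise fun i j => inner 𝕜 (g i) (g j) = 0) :
    ∃ f : ι → E, Orthonormal 𝕜 f ∧ ∀ i, g i = (‖g i‖ : 𝕜) • f i := by
  let v : ι ⊕ Fin (Module.finrank 𝕜 E - Fintype.card ι) → E :=
    Sum.elim (fun i => (‖g i‖⁻¹ : 𝕜) • g i) 0
  have hv : Orthonormal 𝕜 ((Sum.inl '' {i | g i ≠ 0}).domRestrict v) := by
    refine ⟨?_, ?_⟩
    · rintro ⟨_, i, hi, rfl⟩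
      exact norm_smul_inv_norm hi
    · rintro ⟨_, i, hi, rfl⟩ ⟨_, j, hj, rfl⟩ hij
      have hij' : i ≠ j := fun h => hij (by simp only [h])
      simp [v, inner_smul_left, inner_smul_right, hg hij']
  obtain ⟨f, hf⟩ := hv.exists_orthonormalBasis_extension_of_card_eq (by simp [h_card])
  refine ⟨f ∘ Sum.inl, f.orthonormal.comp _ Sum.inl_injective, fun i => ?_⟩
  rcases eq_or_ne (g i) 0 with hi | hi
  · simp [hi]
  · have hi' : (‖g i‖ : 𝕜) ≠ 0 := RCLike.ofReal_ne_zero.2 (norm_ne_zero_iff.2 hi)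
    rw [Function.comp_apply, hf _ ⟨i, hi, rfl⟩]
    exact (smul_inv_smul₀ hi' (g i)).symm

/-- The left singular vectors are the eigenvectors of `M * Mᴴ`. -/
theorem exists_singularValueDecomposition {n k : Type*} [Fintype n] [Fintype k]
    (h_card : Fintype.card n ≤ Fintype.card k) (M : Matrix n k ℂ) :
    ∃ (s : n → ℝ) (e : n → EuclideanSpace ℂ n) (f : n → EuclideanSpace ℂ k), (∀ l, 0 ≤ s l) ∧
      Orthonormal ℂ e ∧ Orthonormal ℂ f ∧ ∀ i j, M i j = ∑ l, (s l : ℂ) * (e l i * f l j) := by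
  classical
  have hM := Matrix.isHermitian_mul_conjTranspose_self M
  let e := hM.eigenvectorBasis
  let g : n → EuclideanSpace ℂ k := fun l => WithLp.toLp 2 (star (e l).ofLp ᵥ* M)
  have hg : Pairwise fun i j => inner ℂ (g i) (g j) = 0 := fun i j hij => by
    have h_ortho : (e i).ofLp ⬝ᵥ star (e j).ofLp = 0 := e.orthonormal.2 hij.symm
    calc inner ℂ (g i) (g j)
        = (star (e j).ofLp ᵥ* M) ⬝ᵥ star (star (e i).ofLp ᵥ* M) := rfl
      _ = star (e j).ofLp ⬝ᵥ ((M * Mᴴ) *ᵥ (e i).ofLp) := by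
        rw [Matrix.star_vecMul, star_star, ← Matrix.dotProduct_mulVec, Matrix.mulVec_mulVec]
      _ = 0 := by
        rw [hM.mulVec_eigenvectorBasis, dotProduct_smul, dotProduct_comm, h_ortho, smul_zero]
  obtain ⟨f, hf, hgf⟩ := exists_orthonormal_eq_norm_smul (by simpa using h_card) hg
  refine ⟨fun l => ‖g l‖, e, f, fun l => norm_nonneg _, e.orthonormal, hf, fun i j => ?_⟩
  have h_expand : M i j = ∑ l, e l i * g l j := by
    let U : Matrix n n ℂ := hM.eigenvectorUnitary
    have hU : U * Uᴴ = 1 := Unitary.coe_mul_star_self hM.eigenvectorUnitary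
    calc M i j = (U * (Uᴴ * M)) i j := by rw [← Matrix.mul_assoc, hU, Matrix.one_mul]
      _ = ∑ l, e l i * g l j := rfl
  rw [h_expand]
  refine Finset.sum_congr rfl fun l _ => ?_
  conv_lhs => rw [hgf l]
  exact mul_left_comm _ _ _

theorem exists_isSchmidtVector_of_eq_sum {a b d : ℕ} (hd : d = min a b)
    {ψ : EuclideanSpace ℂ (Fin a × Fin b)} {s : Fin d → ℝ} {e : Fin d → EuclideanSpace ℂ (Fin a)}
    {f : Fin d → EuclideanSpace ℂ (Fin b)} (hs : ∀ l, 0 ≤ s l) (he : Orthonormal ℂ e)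
    (hf : Orthonormal ℂ f) (hψ : ∀ p, ψ p = ∑ l, (s l : ℂ) * (e l p.1 * f l p.2)) :
    ∃ ξ : Fin (min a b) → ℝ, IsSchmidtVector ψ ξ := by
  subst hd
  exact ⟨s, hs, e, f, he, hf, hψ⟩

theorem exists_isSchmidtVector {a b : ℕ} (ψ : EuclideanSpace ℂ (Fin a × Fin b)) :
    ∃ ξ : Fin (min a b) → ℝ, IsSchmidtVector ψ ξ := by
  rcases le_total a b with hab | hab
  · obtain ⟨s, e, f, hs, he, hf, h_svd⟩ := exists_singularValueDecomposition
      (by simpa using hab) (Matrix.of fun (i : Fin a) (j : Fin b) => ψ (i, j))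
    exact exists_isSchmidtVector_of_eq_sum (min_eq_left hab).symm hs he hf
      fun p => h_svd p.1 p.2
  · obtain ⟨s, e, f, hs, he, hf, h_svd⟩ := exists_singularValueDecomposition
      (by simpa using hab) (Matrix.of fun (j : Fin b) (i : Fin a) => ψ (i, j))
    refine exists_isSchmidtVector_of_eq_sum (min_eq_right hab).symm hs hf he
      fun p => (h_svd p.2 p.1).trans ?_
    simp only [mul_comm (e _ _)]

end SchmidtDecomposition

section VectorNorms

variable {ι : Type*} [Fintype ι]

theorem norm_sq_le_iff_forall_sq_le [Nonempty ι] {ω : ι → ℝ} {s : ℝ} :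
    ‖ω‖ ^ 2 ≤ s ↔ ∀ i, ω i ^ 2 ≤ s := by
  refine ⟨fun h i => ?_, fun h => ?_⟩
  · rw [← sq_abs]
    exact (pow_le_pow_left₀ (abs_nonneg _) (norm_le_pi_norm ω i) 2).trans h
  · have hs : 0 ≤ s := (sq_nonneg _).trans (h (Classical.arbitrary ι))
    rw [← Real.le_sqrt (norm_nonneg _) hs, pi_norm_le_iff_of_nonempty]
    exact fun i => Real.abs_le_sqrt (h i)

theorem norm_toLp_le_one_iff {ω : ι → ℝ} : ‖WithLp.toLp 2 ω‖ ≤ 1 ↔ ∑ i, ω i ^ 2 ≤ 1 := by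
  rw [← sq_le_one_iff₀ (norm_nonneg _), EuclideanSpace.norm_sq_eq]
  simp only [Real.norm_eq_abs, sq_abs]

theorem isCompact_norm_toLp_le_one : IsCompact {ω : ι → ℝ | ‖WithLp.toLp 2 ω‖ ≤ 1} := by
  have h_preimage := (PiLp.homeomorph 2 fun _ : ι => ℝ).symm.isClosedEmbedding.isCompact_preimage
    (isCompact_closedBall 0 1)
  convert h_preimage using 1
  ext ω
  exact mem_closedBall_zero_iff.symm

theorem isCompact_flatVectors (t : ℝ) : IsCompact (flatVectors ι t) := by
  have h_closed : IsClosed {ω : ι → ℝ | ∀ i, ω i ^ 2 ≤ t} := by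
    simp only [Set.ofPred_forall]
    exact isClosed_iInter fun i => isClosed_le (by fun_prop) continuous_const
  have h_compact := (isCompact_norm_toLp_le_one (ι := ι)).inter_right
    (isClosed_Ici (a := (0 : ι → ℝ)) |>.inter h_closed)
  convert h_compact using 1
  ext ω
  exact and_left_comm

theorem continuous_dotProduct_left (ξ : ι → ℝ) : Continuous fun ω : ι → ℝ => ξ ⬝ᵥ ω := by
  unfold dotProduct
  fun_prop

end VectorNorms

section PureStateProgram

variable {d : ℕ} {ξ ω : Fin d → ℝ} {ε : ℝ}

theorem isCompact_feasibleVectors (ξ : Fin d → ℝ) (ε : ℝ) : IsCompact (feasibleVectors ξ ε) := by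
  have h_closed : IsClosed {ω : Fin d → ℝ | √(1 - ε) ≤ ξ ⬝ᵥ ω} :=
    isClosed_le continuous_const (continuous_dotProduct_left ξ)
  exact (isCompact_norm_toLp_le_one.inter_right (isClosed_Ici (a := (0 : Fin d → ℝ)))).inter_left
    h_closed

theorem mem_feasibleVectors_and_norm_sq_le_iff [Nonempty (Fin d)] (hξ : ∀ i, 0 ≤ ξ i) {t : ℝ} :
    ω ∈ feasibleVectors ξ ε ∧ ‖ω‖ ^ 2 ≤ t ↔
      ω ∈ flatVectors (Fin d) t ∧ 1 - ε ≤ (ξ ⬝ᵥ ω) ^ 2 := by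
  have h_sqrt (hω : ∀ i, 0 ≤ ω i) : √(1 - ε) ≤ ξ ⬝ᵥ ω ↔ 1 - ε ≤ (ξ ⬝ᵥ ω) ^ 2 :=
    Real.sqrt_le_left (dotProduct_nonneg_of_nonneg hξ hω)
  rw [norm_sq_le_iff_forall_sq_le]
  constructor
  · rintro ⟨⟨h_le, h_norm, h_nonneg⟩, h_flat⟩
    exact ⟨⟨h_nonneg, h_norm, h_flat⟩, (h_sqrt h_nonneg).1 h_le⟩
  · rintro ⟨⟨h_nonneg, h_norm, h_flat⟩, h_le⟩
    exact ⟨⟨(h_sqrt h_nonneg).2 h_le, h_norm, h_nonneg⟩, h_flat⟩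

theorem norm_pos_of_mem_feasibleVectors (hε : ε < 1) (hω : ω ∈ feasibleVectors ξ ε) :
    0 < ‖ω‖ := by
  refine norm_pos_iff.2 fun h_zero => (Real.sqrt_pos.2 (sub_pos.2 hε)).not_ge ?_
  simpa only [h_zero, dotProduct_zero] using hω.1

theorem exists_isLeast_norm_sq_feasibleVectors [Nonempty (Fin d)] (hξ : ∀ i, 0 ≤ ξ i)
    (hξξ : ξ ⬝ᵥ ξ = 1) (hε0 : 0 ≤ ε) (hε1 : ε < 1) :
    ∃ μ, 0 < μ ∧ μ ≤ 1 ∧ IsLeast ((fun ω => ‖ω‖ ^ 2) '' feasibleVectors ξ ε) μ := by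
  have hξ_sum : ∑ i, ξ i ^ 2 = 1 := by simpa only [dotProduct, ← sq] using hξξ
  have hξ_mem : ξ ∈ feasibleVectors ξ ε :=
    ⟨by rw [hξξ]; exact Real.sqrt_le_one.2 (by linarith), norm_toLp_le_one_iff.2 hξ_sum.le, hξ⟩
  obtain ⟨μ, hμ⟩ := ((isCompact_feasibleVectors ξ ε).image (continuous_norm.pow 2)).exists_isLeast
    ⟨_, ξ, hξ_mem, rfl⟩
  have hξ_norm : ‖ξ‖ ^ 2 ≤ 1 := norm_sq_le_iff_forall_sq_le.2 fun i =>
    hξ_sum ▸ Finset.single_le_sum (fun j _ => sq_nonneg (ξ j)) (Finset.mem_univ i)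
  refine ⟨μ, ?_, (hμ.2 ⟨ξ, hξ_mem, rfl⟩).trans hξ_norm, hμ⟩
  obtain ⟨ω, hω, rfl⟩ := hμ.1
  exact pow_pos (norm_pos_of_mem_feasibleVectors hε1 hω) 2

theorem isConvex_pureStateQCLP (ξ : Fin d → ℝ) (ε : ℝ) : (pureStateQCLP ξ ε).IsConvex := by
  have h_diag {v : Fin d ⊕ Unit → ℝ} (hv : 0 ≤ v) : (Matrix.diagonal v).PosSemidef :=
    Matrix.PosSemidef.diagonal hv
  rintro (_ | _ | _ | _)
  · exact h_diag (Pi.single_nonneg.2 zero_le_one)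
  · exact Matrix.PosSemidef.zero
  · exact Matrix.PosSemidef.zero
  · exact h_diag (Sum.forall.2 ⟨fun _ => zero_le_one, fun _ => le_rfl⟩)

theorem mem_feasible_pureStateQCLP_iff [Nonempty (Fin d)] {s : ℝ} :
    Sum.elim ω (fun _ => s) ∈ (pureStateQCLP ξ ε).feasible ↔
      ω ∈ feasibleVectors ξ ε ∧ ‖ω‖ ^ 2 ≤ s := by
  have h_entry (i : Fin d) : Sum.elim ω (fun _ => s) ⬝ᵥ
      (Matrix.diagonal (Pi.single (Sum.inl i) 1) *ᵥ Sum.elim ω fun _ : Unit => s) = ω i ^ 2 := by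
    simp [dotProduct, Matrix.mulVec_diagonal, Pi.single_apply, sq]
  have h_norm : Sum.elim ω (fun _ => s) ⬝ᵥ
      (Matrix.diagonal (Sum.elim 1 0) *ᵥ Sum.elim ω fun _ : Unit => s) = ∑ i, ω i ^ 2 := by
    simp [dotProduct, Matrix.mulVec_diagonal, sq]
  have h_overlap : Sum.elim (-ξ) 0 ⬝ᵥ Sum.elim ω (fun _ : Unit => s) = -(ξ ⬝ᵥ ω) := by
    simp [dotProduct]
  rw [norm_sq_le_iff_forall_sq_le, feasibleVectors, Set.mem_ofPred_eq, norm_toLp_le_one_iff]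
  simp only [QCLP.feasible, pureStateQCLP, Set.mem_ofPred_eq, Sum.forall, Bool.forall_bool,
    h_entry, h_norm, h_overlap, Matrix.zero_mulVec, dotProduct_zero, zero_dotProduct,
    single_dotProduct, Sum.elim_inl, Sum.elim_inr, add_zero, zero_add, neg_one_mul,
    ← sub_eq_add_neg, sub_nonpos, neg_add_nonpos_iff]
  tauto

theorem isLeast_objective_pureStateQCLP [Nonempty (Fin d)] {μ : ℝ}
    (hμ : IsLeast ((fun ω => ‖ω‖ ^ 2) '' feasibleVectors ξ ε) μ) :
    IsLeast ((fun x => (pureStateQCLP ξ ε).c ⬝ᵥ x) '' (pureStateQCLP ξ ε).feasible) μ := by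
  have h_objective (x : Fin d ⊕ Unit → ℝ) : (pureStateQCLP ξ ε).c ⬝ᵥ x = x (Sum.inr ()) := by
    simp [pureStateQCLP]
  simp only [h_objective]
  constructor
  · obtain ⟨ω, hω, hω_norm⟩ := hμ.1
    exact ⟨Sum.elim ω fun _ => μ, mem_feasible_pureStateQCLP_iff.2 ⟨hω, hω_norm.le⟩, rfl⟩
  · rintro _ ⟨x, hx, rfl⟩
    have hx_eq : x = Sum.elim (x ∘ Sum.inl) fun _ => x (Sum.inr ()) :=
      (Sum.elim_comp_inl_inr x).symm
    rw [hx_eq] at hx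
    obtain ⟨hω, h_le⟩ := mem_feasible_pureStateQCLP_iff.1 hx
    exact (hμ.2 ⟨_, hω, rfl⟩).trans h_le

end PureStateProgram

section DistillableEntanglement

variable {a b : ℕ} {ψ : EuclideanSpace ℂ (Fin a × Fin b)} {ξ : Fin (min a b) → ℝ}

theorem IsSchmidtVector.dotProduct_self (hξ : IsSchmidtVector ψ ξ) : ξ ⬝ᵥ ξ = ‖ψ‖ ^ 2 := by
  obtain ⟨e, f, he, hf, hψ⟩ := hξ.exists_eq_sum_productVector
  have h_inner := (orthonormal_productVector he hf).inner_sum (fun i => (ξ i : ℂ))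
    (fun i => (ξ i : ℂ)) Finset.univ
  rw [← hψ, inner_self_eq_norm_sq_to_K] at h_inner
  simp only [Complex.conj_ofReal, ← Complex.ofReal_mul, ← Complex.ofReal_sum] at h_inner
  exact Complex.ofReal_injective (h_inner.symm.trans (Complex.ofReal_pow _ _).symm)

theorem isGreatest_distillationFidelity (O : OpClass) {m : ℕ} (hm : 0 < m)
    (hξ : IsSchmidtVector ψ ξ) :
    IsGreatest ((fun ω => (ξ ⬝ᵥ ω) ^ 2) '' flatVectors (Fin (min a b)) (1 / m))
      (distillationFidelity O (rankOne ψ.ofLp) m) := by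
  obtain ⟨F, ⟨ω, hω, rfl⟩, hF⟩ := ((isCompact_flatVectors (ι := Fin (min a b)) (1 / m)).image
    ((continuous_dotProduct_left ξ).pow 2)).exists_isGreatest ⟨_, 0, by simp [flatVectors], rfl⟩
  have h_upper : (ξ ⬝ᵥ ω) ^ 2 ∈ upperBounds {x | ∃ Λ ∈ O.ops a b m m,
      x = ((Λ (rankOne ψ.ofLp))ᴴ * maxEntangled m).trace.re} := by
    rintro _ ⟨Λ, hΛ, rfl⟩
    obtain ⟨ω', hω', h_le⟩ := exists_mem_flatVectors_re_trace_le hm hξ hΛ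
    exact h_le.trans (hF ⟨ω', hω', rfl⟩)
  obtain ⟨Λ, hΛ, h_le⟩ := exists_isOneWayLOCC_sq_dotProduct_le hm hξ hω
  have h_eq : distillationFidelity O (rankOne ψ.ofLp) m = (ξ ⬝ᵥ ω) ^ 2 :=
    le_antisymm (csSup_le ⟨_, Λ, hΛ.mem_ops O, rfl⟩ h_upper)
      (h_le.trans (le_csSup ⟨_, h_upper⟩ ⟨Λ, hΛ.mem_ops O, rfl⟩))
  rw [h_eq]
  exact ⟨⟨ω, hω, rfl⟩, hF⟩

theorem mem_distillableSizes_iff [Nonempty (Fin (min a b))] (O : OpClass) (hξ : IsSchmidtVector ψ ξ)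
    {ε μ : ℝ} (hμ : IsLeast ((fun ω => ‖ω‖ ^ 2) '' feasibleVectors ξ ε) μ) {m : ℕ} :
    m ∈ distillableSizes O (rankOne ψ.ofLp) ε ↔ 1 ≤ m ∧ μ ≤ 1 / m := by
  refine and_congr_right fun hm => ?_
  obtain ⟨⟨ω, hω, h_eq⟩, h_max⟩ := isGreatest_distillationFidelity O hm hξ
  constructor
  · intro h_le
    obtain ⟨hω_feasible, hω_norm⟩ :=
      (mem_feasibleVectors_and_norm_sq_le_iff hξ.1).2 ⟨hω, h_le.trans_eq h_eq.symm⟩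
    exact (hμ.2 ⟨ω, hω_feasible, rfl⟩).trans hω_norm
  · intro h_le
    obtain ⟨ω', hω', h_norm⟩ := hμ.1
    obtain ⟨hω'_flat, hω'_le⟩ :=
      (mem_feasibleVectors_and_norm_sq_le_iff hξ.1).1 ⟨hω', h_norm.le.trans h_le⟩
    exact hω'_le.trans (h_max ⟨ω', hω'_flat, rfl⟩)

theorem isGreatest_distillableSizes [Nonempty (Fin (min a b))] (O : OpClass)
    (hξ : IsSchmidtVector ψ ξ) {ε μ : ℝ} (hμ_pos : 0 < μ) (hμ_le : μ ≤ 1)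
    (hμ : IsLeast ((fun ω => ‖ω‖ ^ 2) '' feasibleVectors ξ ε) μ) :
    IsGreatest (distillableSizes O (rankOne ψ.ofLp) ε) ⌊μ⁻¹⌋₊ := by
  have h_mem {m : ℕ} :
      m ∈ distillableSizes O (rankOne ψ.ofLp) ε ↔ 1 ≤ m ∧ m ≤ ⌊μ⁻¹⌋₊ := by
    refine (mem_distillableSizes_iff O hξ hμ).trans (and_congr_right fun hm => ?_)
    rw [one_div, le_inv_comm₀ hμ_pos (Nat.cast_pos.2 hm), Nat.le_floor_iff (inv_nonneg.2 hμ_pos.le)]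
  have h_one_le : 1 ≤ ⌊μ⁻¹⌋₊ := Nat.le_floor (by simpa using (one_le_inv₀ hμ_pos).2 hμ_le)
  exact ⟨h_mem.2 ⟨h_one_le, le_rfl⟩, fun m hm => (h_mem.1 hm).2⟩

theorem logFloor_neg_logb {μ : ℝ} (hμ : 0 < μ) :
    logFloor (-Real.logb 2 μ) = Real.logb 2 ⌊μ⁻¹⌋₊ := by
  rw [logFloor, Real.rpow_neg zero_le_two, Real.rpow_logb zero_lt_two (by norm_num) hμ,
    natCast_floor_eq_intCast_floor (inv_nonneg.2 hμ.le)]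

end DistillableEntanglement

end

theorem mainTheorem3 {a b : ℕ} (ψ : EuclideanSpace ℂ (Fin a × Fin b)) (hψ : ‖ψ‖ = 1)
    (ε : ℝ) (hε0 : 0 ≤ ε) (hε1 : ε < 1) :
    (∃ ξ : Fin (min a b) → ℝ, IsSchmidtVector ψ ξ) ∧
    ∀ ξ : Fin (min a b) → ℝ, IsSchmidtVector ψ ξ →
      (pureStateQCLP ξ ε).IsConvex ∧
      (∀ (ω : Fin (min a b) → ℝ) (s : ℝ),
        Sum.elim ω (fun _ => s) ∈ (pureStateQCLP ξ ε).feasible ↔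
          ω ∈ feasibleVectors ξ ε ∧ ‖ω‖ ^ 2 ≤ s) ∧
      ∃ μ : ℝ, 0 < μ ∧
        IsLeast ((fun ω : Fin (min a b) → ℝ => ‖ω‖ ^ 2) '' feasibleVectors ξ ε) μ ∧
        IsLeast ((fun x => (pureStateQCLP ξ ε).c ⬝ᵥ x) '' (pureStateQCLP ξ ε).feasible) μ ∧
        ∀ O : OpClass,
          (∃ M, IsGreatest (distillableSizes O (rankOne ψ.ofLp) ε) M) ∧
          distillableEntanglement O (rankOne ψ.ofLp) ε = logFloor (-Real.logb 2 μ) := by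
  refine ⟨exists_isSchmidtVector ψ, fun ξ hξ => ?_⟩
  have hξξ : ξ ⬝ᵥ ξ = 1 := by rw [hξ.dotProduct_self, hψ, one_pow]
  have : Nonempty (Fin (min a b)) := not_isEmpty_iff.1 fun _ => by simp [dotProduct] at hξξ
  obtain ⟨μ, hμ_pos, hμ_le, hμ⟩ := exists_isLeast_norm_sq_feasibleVectors hξ.1 hξξ hε0 hε1
  refine ⟨isConvex_pureStateQCLP ξ ε, fun ω s => mem_feasible_pureStateQCLP_iff, μ, hμ_pos, hμ,
    isLeast_objective_pureStateQCLP hμ, fun O => ?_⟩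
  have h_greatest := isGreatest_distillableSizes O hξ hμ_pos hμ_le hμ
  refine ⟨⟨_, h_greatest⟩, ?_⟩
  rw [distillableEntanglement, h_greatest.csSup_eq, logFloor_neg_logb hμ_pos]
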